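/- Let $r\ge 1$ be an integer, $q=2^{2r+1}$, and let $X_1,\dots,X_5$ be homogeneous coordinates of $\mathrm{PG}(4,q)$, with $U_i$ the point having $1$ in the $i$-th position and $0$ elsewhere. Let $\mathcal Q(4,q)$ be the parabolic quadric $X_1X_5+X_2X_4+X_3^2=0$, whose nucleus is $U_3$. An \emph{elliptic quadric of} $\mathcal Q(4,q)$ is the intersection of $\mathcal Q(4,q)$ with a hyperplane ($\cong\mathrm{PG}(3,q)$) on which the form $X_1X_5+X_2X_4+X_3^2$ is equivalent to $Y_1Y_2+f(Y_3,Y_4)$ for some anisotropic binary quadratic form $f$. A \emph{Suzuki--Tits ovoid of} $\mathcal Q(4,q)$ is the image, under a projectivity of $\mathrm{PG}(4,q)$ leaving $\mathcal Q(4,q)$ invariant, of $$\{(1,x_2,x_3,x_4,x_5) : x_4+x_2^{\sigma+1}+x_3^{\sigma}=x_5+x_2x_3^{\sigma}+x_2^{\sigma+2}+x_3^2=0\}\cup\{U_5\},\qquad x^{\sigma}=x^{2^{r+1}},$$ where $x_2,\dots,x_5\in\mathbb F_q$. A \emph{cap} is a set of points no three of which are collinear; a cap with $n$ points is \emph{complete}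 if it is not contained in a cap with $n+1$ points. \textbf{Theorem.} Let $\mathcal E'$ be an elliptic quadric of $\mathcal Q(4,q)$ and let $\mathcal T'$ be a Suzuki--Tits ovoid of $\mathcal Q(4,q)$. Then $\mathcal E'\cup\mathcal T'\cup\{U_3\}$ is a complete cap of $\mathrm{PG}(4,q)$, and its size is $2q^2-q+\sqrt{2q}+2$ or $2q^2-q-\sqrt{2q}+2$. Moreover, for every such $q$ both sizes occur, for suitable $\mathcal E'$ and $\mathcal T'$. -/

import Mathlib

open scoped LinearAlgebra.Projectivization

/-- A cap: a set of points of a projective space no three (distinct) of which are collinear. -/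
def IsCap {F V : Type*} [Field F] [AddCommGroup V] [Module F V] (S : Set (ℙ F V)) : Prop :=
  ∀ A ∈ S, ∀ B ∈ S, ∀ C ∈ S, A ≠ B → A ≠ C → B ≠ C →
    ¬ Projectivization.IsCollinear ({A, B, C} : Set (ℙ F V))

/-- A complete cap (of a finite projective space): an `n`-cap that is not contained in an
`(n + 1)`-cap. -/
def IsCompleteCap {F V : Type*} [Field F] [AddCommGroup V] [Module F V] (S : Set (ℙ F V)) :
    Prop :=
  IsCap S ∧ ¬ ∃ S' : Set (ℙ F V), IsCap S' ∧ S ⊆ S' ∧ S'.ncard = S.ncard + 1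

/-- The quadric of a quadratic form: the set of its singular points. -/
def quadricPoints {F V : Type*} [Field F] [AddCommGroup V] [Module F V]
    (Q : QuadraticForm F V) : Set (ℙ F V) :=
  {P | Q P.rep = 0}

/-- Membership in a quadric does not depend on the chosen representative vector. -/
theorem mk_mem_quadricPoints {F V : Type*} [Field F] [AddCommGroup V] [Module F V]
    (Q : QuadraticForm F V) (v : V) (hv : v ≠ 0) :
    Projectivization.mk F v hv ∈ quadricPoints Q ↔ Q v = 0 := by
  obtain ⟨a, ha⟩ := Projectivization.exists_smul_eq_mk_rep F v hv
  have h : Q ((a : F) • v) = 0 ↔ Q v = 0 := by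
    rw [QuadraticMap.map_smul]
    simp
  simpa [quadricPoints, ← ha, Units.smul_def] using h

/-- A quadratic form defines an elliptic quadric of a three-dimensional projective space when it is
equivalent to `x₁ x₂ + f(x₃, x₄)` with `f` an anisotropic binary quadratic form. -/
def IsEllipticForm {F W : Type*} [Field F] [AddCommGroup W] [Module F W]
    (Q : QuadraticForm F W) : Prop :=
  ∃ f : QuadraticForm F (Fin 2 → F), f.Anisotropic ∧
    Q.Equivalent ((QuadraticMap.proj (0 : Fin 2) 1 : QuadraticForm F (Fin 2 → F)).prod f)

/-- The quadratic form `X₁ X₅ + X₂ X₄ + X₃²` (coordinates are indexed from `0` in the code). -/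
def parabolicForm (F : Type*) [Field F] : QuadraticForm F (Fin 5 → F) :=
  QuadraticMap.proj 0 4 + QuadraticMap.proj 1 3 + QuadraticMap.proj 2 2

/-- The parabolic quadric `Q(4, q)` of `PG(4, q)`. -/
def parabolicQuadric (F : Type*) [Field F] : Set (ℙ F (Fin 5 → F)) :=
  quadricPoints (parabolicForm F)

/-- The coordinate point `U_{i+1}` of `PG(4, q)`. -/
def coordPoint (F : Type*) [Field F] (i : Fin 5) : ℙ F (Fin 5 → F) :=
  Projectivization.mk F (Pi.single i 1) (by simp)

/-- An elliptic quadric of `Q(4, q)`: the intersection of `Q(4, q)` with a hyperplane of `PG(4, q)`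
in which `Q(4, q)` induces an elliptic quadric. -/
def IsEllipticSection {F : Type*} [Field F] (E : Set (ℙ F (Fin 5 → F))) : Prop :=
  ∃ H : Submodule F (Fin 5 → F), Module.finrank F H = 4 ∧
    IsEllipticForm ((parabolicForm F).restrict H) ∧
    E = parabolicQuadric F ∩ {P | P ∈ H.projectivization}

/-- The Suzuki–Tits ovoid of `Q(4, q)`, `q = 2 ^ (2 * r + 1)`, in canonical form:
the points `(1, x, y, z, w)` with `z + x^(σ+1) + y^σ = 0` and `w + x y^σ + x^(σ+2) + y^2 = 0`,
where `a^σ = a ^ (2 ^ (r + 1))`, together with `U₅`. -/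
def suzukiTitsOvoid (F : Type*) [Field F] (r : ℕ) : Set (ℙ F (Fin 5 → F)) :=
  {P | ∃ (x y z w : F) (h : ![1, x, y, z, w] ≠ 0),
      z + x ^ (2 ^ (r + 1) + 1) + y ^ 2 ^ (r + 1) = 0 ∧
      w + x * y ^ 2 ^ (r + 1) + x ^ (2 ^ (r + 1) + 2) + y ^ 2 = 0 ∧
      P = Projectivization.mk F ![1, x, y, z, w] h} ∪
  {coordPoint F 4}

/-- A Suzuki–Tits ovoid of `Q(4, q)`: an image of the canonical one under a projectivity of
`PG(4, q)` leaving `Q(4, q)` invariant. -/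
def IsSuzukiTitsOvoid {F : Type*} [Field F] (r : ℕ) (T : Set (ℙ F (Fin 5 → F))) : Prop :=
  ∃ g : (Fin 5 → F) ≃ₗ[F] (Fin 5 → F),
    Projectivization.map g.toLinearMap g.injective '' parabolicQuadric F = parabolicQuadric F ∧
    T = Projectivization.map g.toLinearMap g.injective '' suzukiTitsOvoid F r

/-! Write t for the inverse of σ, so that x^σ = t(x)² and t(t(x))² = x, and note that 2^(r+1) =
√(2q).

Cap: distinct singular points span a line of the quadric exactly when they are orthogonal for the
polar form, whose radical is the nucleus. Neither an elliptic section E = Q(4,q) ∩ H nor a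
Suzuki–Tits ovoid T contains two distinct orthogonal points. Three collinear singular points are
pairwise orthogonal, and two of any three points of E ∪ T lie in the same set; a line through the
nucleus meets the quadric only once.

Completeness rests on three counts: |T ∩ H| = q + 1 ± √(2q) (`ncard_ovoid_section_eq`); for a
singular point R, R^⊥ meets T ∩ H in at most √(2q) points (`ncard_ovoid_section_polar_le`); and R^⊥
meets T in at least q + 1 points if R is not in T (`card_add_one_le_ncard_ovoid_polar`). For P
singular and off T, the last two give b in T orthogonal to P and off H; the line Pb lies in the
quadric and meets H in a point of E. For P nonsingular and not the nucleus, the transvection τ with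
centre P preserves the quadric, and P, x, τ(x) are collinear. The first two counts, applied to the
preimage of H under τ, give b in T with τ(b) in E and τ(b) ≠ b. Both arguments need 2√(2q) < q + 1.

Size: it is 2q² + 3 - |T ∩ H|. The intersection number comes from the sums of χ(x^(σ+1) + bx), with
χ the trace character; such a sum has square 2q when χ(b) = -1 (`titsSum_sq`), and ellipticity of H
supplies that condition. -/

/-! ### The trace character in characteristic two. -/

section ArtinSchreier

variable {F : Type*} [Field F]

open Classical in
/-- The additive character of a finite field of characteristic two that is trivial exactly on the
elements of the form `u ^ 2 + u`. -/
noncomputable def asSign (x : F) : ℤ := if ∃ u : F, u ^ 2 + u = x then 1 else -1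

theorem asSign_eq_one_iff (x : F) : asSign x = 1 ↔ ∃ u : F, u ^ 2 + u = x := by
  unfold asSign; split_ifs with h <;> simp [h]

theorem asSign_eq_neg_one_iff (x : F) : asSign x = -1 ↔ ¬ ∃ u : F, u ^ 2 + u = x := by
  unfold asSign; split_ifs with h <;> simp [h]

theorem asSign_mul_self (x : F) : asSign x * asSign x = 1 := by
  unfold asSign; split_ifs <;> simp

theorem asSign_eq_or (x : F) : asSign x = 1 ∨ asSign x = -1 := by
  unfold asSign; split_ifs <;> simp

@[simp] theorem asSign_zero : asSign (0 : F) = 1 :=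
  (asSign_eq_one_iff 0).2 ⟨0, by simp⟩

variable [CharP F 2]

/-- The Artin–Schreier map `u ↦ u ^ 2 + u`. -/
def asHom (F : Type*) [Field F] [CharP F 2] : F →+ F where
  toFun u := u ^ 2 + u
  map_zero' := by simp
  map_add' x y := by grind

theorem asHom_ker_card : Nat.card (asHom F).ker = 2 := by
  have h : ((asHom F).ker : Set F) = {0, 1} := by
    ext x
    simp only [SetLike.mem_coe, AddMonoidHom.mem_ker, Set.mem_insert_iff, Set.mem_singleton_iff]
    change x ^ 2 + x = 0 ↔ _
    constructor
    · intro h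
      have : x * (x + 1) = 0 := by linear_combination h
      rcases mul_eq_zero.1 this with h | h
      · exact Or.inl h
      · right; grind
    · rintro (rfl | rfl) <;> grind
  have : Nat.card ((asHom F).ker : Set F) = 2 := by
    rw [h, Nat.card_coe_set_eq, Set.ncard_pair zero_ne_one]
  exact this

variable [Fintype F]

theorem asHom_range_index : (asHom F).range.index = 2 := by
  have h1 := AddSubgroup.card_mul_index (asHom F).range
  have h2 := AddSubgroup.card_mul_index (asHom F).ker
  rw [AddSubgroup.index_ker, asHom_ker_card] at h2
  have h3 : 0 < Nat.card (asHom F).range := Nat.card_pos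
  rw [← h2, mul_comm] at h1
  exact Nat.eq_of_mul_eq_mul_right h3 h1

theorem asSign_add (x y : F) : asSign (x + y) = asSign x * asSign y := by
  have h := AddSubgroup.add_mem_iff_of_index_two (asHom_range_index (F := F)) (a := x) (b := y)
  have hm : ∀ z : F, z ∈ (asHom F).range ↔ asSign z = 1 := fun z => by
    rw [asSign_eq_one_iff]; exact Iff.rfl
  rw [hm, hm, hm] at h
  rcases asSign_eq_or x with hx | hx <;> rcases asSign_eq_or y with hy | hy <;>
    rcases asSign_eq_or (x + y) with hxy | hxy <;> simp [hx, hy, hxy] at h ⊢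

theorem asSign_sq (x : F) : asSign (x ^ 2) = asSign x := by
  have h1 : asSign (x ^ 2 + x) = 1 := (asSign_eq_one_iff _).2 ⟨x, rfl⟩
  rw [asSign_add] at h1
  rcases asSign_eq_or x with hx | hx <;> rcases asSign_eq_or (x ^ 2) with hy | hy <;>
    simp [hx, hy] at h1 ⊢

theorem exists_asSign_eq_neg_one : ∃ x : F, asSign x = -1 := by
  by_contra! h
  have h1 : (asHom F).range = ⊤ := by
    rw [eq_top_iff]
    intro x _
    exact (asSign_eq_one_iff x).1 ((asSign_eq_or x).resolve_right (h x))
  have h2 := asHom_range_index (F := F)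
  rw [h1, AddSubgroup.index_top] at h2
  omega

theorem sum_asSign : ∑ x : F, asSign x = 0 := by
  obtain ⟨a, ha⟩ := exists_asSign_eq_neg_one (F := F)
  have h : ∑ x : F, asSign (a + x) = ∑ x : F, asSign x :=
    Equiv.sum_comp (Equiv.addLeft a) (fun x => asSign x)
  simp only [asSign_add, ha, ← Finset.mul_sum] at h
  linarith

open Classical in
theorem sum_asSign_mul (c : F) :
    ∑ x : F, asSign (c * x) = if c = 0 then (Fintype.card F : ℤ) else 0 := by
  split_ifs with h
  · simp [h]
  · rw [← sum_asSign (F := F)]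
    exact Equiv.sum_comp (Equiv.mulLeft₀ c h) (fun x => asSign x)

open Classical in
/-- Counting the zeros of a function by means of the character. -/
theorem card_mul_card_zeros {α : Type*} [Fintype α] (f : α → F) :
    (Fintype.card F : ℤ) * (Finset.univ.filter fun a => f a = 0).card =
      ∑ l : F, ∑ a : α, asSign (l * f a) := by
  rw [Finset.sum_comm]
  have : ∀ a : α, ∑ l : F, asSign (l * f a) = if f a = 0 then (Fintype.card F : ℤ) else 0 := by
    intro a
    rw [← sum_asSign_mul]
    exact Finset.sum_congr rfl fun x _ => by rw [mul_comm]
  simp only [this, Finset.sum_ite, Finset.sum_const_zero, add_zero, Finset.sum_const,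
    nsmul_eq_mul]
  ring

end ArtinSchreier

/-! ### Character sums attached to the Tits endomorphism. -/

section TitsEndomorphism

variable {F : Type*} [Field F] (t : F →+* F)
  (ht : ∀ x, t (t x) ^ 2 = x)

include ht

theorem map_map_sq (x : F) : t (t x ^ 2) = x := by
  rw [map_pow, ht]

variable [CharP F 2]

/-- If u² + u = 1, then t(u) is another root, hence u or u + 1. In both cases t(t(u)) = u, so u² =
u, a contradiction. -/
theorem asSign_one : asSign (1 : F) = -1 := by
  rw [asSign_eq_neg_one_iff]
  rintro ⟨u, hu⟩
  have h1 : t u ^ 2 + t u = 1 := by rw [← map_pow, ← map_add, hu, map_one]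
  have h2 : (t u + u) * (t u + u + 1) = 0 := by grind
  have h3 : t (t u) = u := by
    rcases mul_eq_zero.1 h2 with h | h
    · have : t u = u := by grind
      rw [this, this]
    · have : t u = u + 1 := by grind
      rw [this, map_add, this, map_one]; grind
  have h4 := ht u
  rw [h3] at h4
  grind

variable [Fintype F]

theorem asSign_map (x : F) : asSign (t x) = asSign x := by
  have hd : ∀ x : F, asSign x = 1 → asSign (t x) = 1 := by
    intro x hx
    obtain ⟨u, hu⟩ := (asSign_eq_one_iff x).1 hx
    exact (asSign_eq_one_iff _).2 ⟨t u, by rw [← hu]; simp⟩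
  have hu : asSign (t x) = 1 → asSign x = 1 := by
    intro h
    have := hd _ h
    rwa [← asSign_sq, ht] at this
  rcases asSign_eq_or x with h | h <;> rcases asSign_eq_or (t x) with h' | h' <;>
    simp_all

/-- The character sum of the quadratic form `x ^ (σ + 1)` twisted by a linear form. -/
noncomputable def titsSum (t : F →+* F) (b : F) : ℤ := ∑ x : F, asSign (x * t x ^ 2 + b * x)

/-- Substituting y = x + u in the double sum leaves an inner sum over x of a linear character with
coefficient t(u)² + t(u), which vanishes only for u = 0 and u = 1. Each of these contributes q: the
second one because χ(1 + b) = χ(1)χ(b) = 1. -/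
theorem titsSum_sq (b : F) (hb : asSign b = -1) :
    titsSum t b ^ 2 = 2 * (Fintype.card F : ℤ) := by
  classical
  have h1 : titsSum t b ^ 2 =
      ∑ u : F, asSign (u * t u ^ 2 + b * u) * ∑ x : F, asSign ((t u ^ 2 + t u) * x) := by
    rw [sq, titsSum, Finset.sum_mul_sum]
    have h2 : ∀ x : F, ∑ y : F, asSign (x * t x ^ 2 + b * x) * asSign (y * t y ^ 2 + b * y) =
        ∑ u : F, asSign (x * t x ^ 2 + b * x) *
          asSign ((x + u) * t (x + u) ^ 2 + b * (x + u)) := fun x =>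
      (Equiv.sum_comp (Equiv.addLeft x)
        (fun y => asSign (x * t x ^ 2 + b * x) * asSign (y * t y ^ 2 + b * y))).symm
    simp only [h2]
    rw [Finset.sum_comm]
    refine Finset.sum_congr rfl fun u _ => ?_
    rw [Finset.mul_sum]
    refine Finset.sum_congr rfl fun x _ => ?_
    -- The adjoint of σ for the trace pairing is t: the character is invariant under t, and t undoes
    -- σ.
    have h3 : asSign (u * t x ^ 2) = asSign (t u * x) := by
      rw [← asSign_map t ht, map_mul, map_map_sq t ht]
    rw [add_mul (t u ^ 2), asSign_add (t u ^ 2 * x), ← h3]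
    rw [← asSign_add, ← asSign_add, ← asSign_add]
    congr 1
    rw [map_add]; grind
  have h4 : ∀ u : F, t u ^ 2 + t u = 0 ↔ u = 0 ∨ u = 1 := by
    intro u
    constructor
    · intro h
      have h5 : t u * (t u + 1) = 0 := by linear_combination h
      rcases mul_eq_zero.1 h5 with h | h
      · left; simpa using h
      · right
        have : t u = t 1 := by rw [map_one]; grind
        exact t.injective this
    · rintro (rfl | rfl) <;> simp; grind
  rw [h1]
  simp only [sum_asSign_mul, h4]
  simp only [mul_ite, mul_zero, Finset.sum_ite, Finset.sum_const_zero, add_zero]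
  have h5 : (Finset.univ.filter fun u : F => u = 0 ∨ u = 1) = {0, 1} := by
    ext; simp
  rw [h5, Finset.sum_pair zero_ne_one]
  simp [asSign_add, asSign_one t ht, hb]
  ring

end TitsEndomorphism

/-! ### The Suzuki–Tits ovoid and its symmetries. -/

section TitsVec

variable {F : Type*} [Field F] (t : F →+* F)

/-- Representatives of the points of the canonical Suzuki–Tits ovoid; `none` gives `U₅`. -/
def titsVec : Option (F × F) → Fin 5 → F
  | none => ![0, 0, 0, 0, 1]
  | some (x, y) =>
    ![1, x, y, x * t x ^ 2 + t y ^ 2, x * (x * t x ^ 2 + t y ^ 2) + y ^ 2]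

theorem titsVec_ne_zero (o : Option (F × F)) : titsVec t o ≠ 0 := by
  intro h
  rcases o with _ | ⟨x, y⟩
  · simpa [titsVec] using congrFun h 4
  · simpa [titsVec] using congrFun h 0

theorem titsVec_eq_of_smul {o o' : Option (F × F)} {c : F}
    (h : titsVec t o = c • titsVec t o') : o = o' := by
  rcases o with _ | ⟨x, y⟩ <;> rcases o' with _ | ⟨x', y'⟩
  · rfl
  · have h0 := congrFun h 0
    have h4 := congrFun h 4
    simp [titsVec] at h0 h4
    simp [← h0] at h4
  · simpa [titsVec] using congrFun h 0
  · have h0 := congrFun h 0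
    have h1 := congrFun h 1
    have h2 := congrFun h 2
    simp [titsVec] at h0 h1 h2
    simp [h1, h2, ← h0]

theorem linearForm_apply (φ : (Fin 5 → F) →ₗ[F] F) (v : Fin 5 → F) :
    φ v = φ (Pi.single 0 1) * v 0 + φ (Pi.single 1 1) * v 1 + φ (Pi.single 2 1) * v 2 +
      φ (Pi.single 3 1) * v 3 + φ (Pi.single 4 1) * v 4 := by
  have h : ∀ i, (Pi.single i (v i) : Fin 5 → F) = v i • Pi.single i 1 := fun i => by
    rw [← Pi.single_smul]; simp
  conv_lhs => rw [← Finset.univ_sum_single v]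
  simp only [Fin.sum_univ_five, h, map_add, map_smul, smul_eq_mul]
  ring

theorem linearForm_titsVec_none (φ : (Fin 5 → F) →ₗ[F] F) :
    φ (titsVec t none) = φ (Pi.single 4 1) := by
  rw [linearForm_apply]; simp [titsVec]

theorem linearForm_titsVec_some (φ : (Fin 5 → F) →ₗ[F] F) (x y : F) :
    φ (titsVec t (some (x, y))) = φ (Pi.single 0 1) + φ (Pi.single 1 1) * x +
      φ (Pi.single 2 1) * y + φ (Pi.single 3 1) * (x * t x ^ 2 + t y ^ 2) +
      φ (Pi.single 4 1) * (x * (x * t x ^ 2 + t y ^ 2) + y ^ 2) := by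
  rw [linearForm_apply]; simp [titsVec]

/-- The action on `PG(4, q)` of the unipotent element of the Suzuki group that fixes `U₅` and maps
`U₁` to the point with parameters `a`, `b`. -/
def titsTranslation (a b : F) : (Fin 5 → F) →ₗ[F] (Fin 5 → F) where
  toFun v := ![v 0, v 1 + a * v 0, v 2 + t a * v 1 + b * v 0,
    v 3 + t a ^ 2 * v 1 + (a * t a ^ 2 + t b ^ 2) * v 0,
    v 4 + a * v 3 + t b ^ 2 * v 1 + (a * (a * t a ^ 2 + t b ^ 2) + b ^ 2) * v 0]
  map_add' u v := by ext i; fin_cases i <;> simp <;> ring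
  map_smul' c v := by ext i; fin_cases i <;> simp <;> ring

/-- The linear map that reverses the order of the coordinates. -/
def coordReverse (F : Type*) [Field F] : (Fin 5 → F) →ₗ[F] (Fin 5 → F) where
  toFun v := ![v 4, v 3, v 2, v 1, v 0]
  map_add' u v := by ext i; fin_cases i <;> simp
  map_smul' c v := by ext i; fin_cases i <;> simp

theorem titsTranslation_injective (a b : F) : Function.Injective (titsTranslation t a b) := by
  rw [← LinearMap.ker_eq_bot, LinearMap.ker_eq_bot']
  intro v hv
  have h0 : v 0 = 0 := congrFun hv 0
  have h1 : v 1 + a * v 0 = 0 := congrFun hv 1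
  have h2 : v 2 + t a * v 1 + b * v 0 = 0 := congrFun hv 2
  have h3 : v 3 + t a ^ 2 * v 1 + (a * t a ^ 2 + t b ^ 2) * v 0 = 0 := congrFun hv 3
  have h4 : v 4 + a * v 3 + t b ^ 2 * v 1 + (a * (a * t a ^ 2 + t b ^ 2) + b ^ 2) * v 0 = 0 :=
    congrFun hv 4
  simp only [h0, mul_zero, add_zero] at h1
  simp only [h0, h1, mul_zero, add_zero] at h2 h3
  simp only [h0, h1, h3, mul_zero, add_zero] at h4
  ext i; fin_cases i <;> assumption

theorem coordReverse_injective : Function.Injective (coordReverse F) := by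
  intro u v h
  ext i; fin_cases i
  · exact congrFun h 4
  · exact congrFun h 3
  · exact congrFun h 2
  · exact congrFun h 1
  · exact congrFun h 0

theorem coordReverse_single (i : Fin 5) :
    coordReverse F (Pi.single i 1) = Pi.single (Fin.rev i) 1 := by
  ext j; fin_cases i <;> fin_cases j <;> simp [coordReverse]

theorem titsTranslation_single_zero (a b : F) :
    titsTranslation t a b (Pi.single 0 1) = titsVec t (some (a, b)) := by
  ext j; fin_cases j <;> simp [titsTranslation, titsVec]

theorem titsTranslation_single_one (a b : F) :
    titsTranslation t a b (Pi.single 1 1) = ![0, 1, t a, t a ^ 2, t b ^ 2] := by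
  ext j; fin_cases j <;> simp [titsTranslation]

theorem titsTranslation_single_two (a b : F) :
    titsTranslation t a b (Pi.single 2 1) = Pi.single 2 1 := by
  ext j; fin_cases j <;> simp [titsTranslation]

theorem titsTranslation_single_three (a b : F) :
    titsTranslation t a b (Pi.single 3 1) = ![0, 0, 0, 1, a] := by
  ext j; fin_cases j <;> simp [titsTranslation]

theorem titsTranslation_single_four (a b : F) :
    titsTranslation t a b (Pi.single 4 1) = Pi.single 4 1 := by
  ext j; fin_cases j <;> simp [titsTranslation]

/-- A linear injection that preserves the ovoid permutes its points. -/
theorem ncard_titsVec_comp [Finite F] (h : (Fin 5 → F) →ₗ[F] (Fin 5 → F))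
    (hi : Function.Injective h)
    (hT : ∀ o, ∃ o' : Option (F × F), ∃ c : F, h (titsVec t o) = c • titsVec t o')
    (R : (Fin 5 → F) → Prop) (hR : ∀ v, ∀ c : F, c ≠ 0 → (R (c • v) ↔ R v)) :
    {o | R (h (titsVec t o))}.ncard = {o | R (titsVec t o)}.ncard := by
  choose e c hec using hT
  have hc : ∀ o, c o ≠ 0 := fun o h0 => by
    have := hec o
    rw [h0, zero_smul, ← map_zero h] at this
    exact titsVec_ne_zero t o (hi this)
  have he : Function.Injective e := by
    intro o o' hoo
    have h1 : h (titsVec t o) = h ((c o * (c o')⁻¹) • titsVec t o') := by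
      rw [map_smul, hec o, hec o', hoo, smul_smul, mul_assoc, inv_mul_cancel₀ (hc o'), mul_one]
    exact titsVec_eq_of_smul t (hi h1)
  have hs : Function.Surjective e := Finite.surjective_of_injective he
  have h2 : {o | R (titsVec t o)} = e '' {o | R (h (titsVec t o))} := by
    ext o
    constructor
    · intro ho
      obtain ⟨o', rfl⟩ := hs o
      refine ⟨o', ?_, rfl⟩
      change R (h (titsVec t o'))
      rw [hec, hR _ _ (hc o')]
      exact ho
    · rintro ⟨o', ho', rfl⟩
      change R (h (titsVec t o')) at ho'
      rwa [hec, hR _ _ (hc o')] at ho'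
  rw [h2, Set.ncard_image_of_injective _ he]

variable (ht : ∀ x, t (t x) ^ 2 = x) [CharP F 2]
include ht

theorem titsTranslation_titsVec (a b : F) (o : Option (F × F)) :
    ∃ o' : Option (F × F), ∃ c : F, titsTranslation t a b (titsVec t o) = c • titsVec t o' := by
  rcases o with _ | ⟨x, y⟩
  · refine ⟨none, 1, ?_⟩
    ext i; fin_cases i <;> simp [titsVec, titsTranslation]
  · refine ⟨some (x + a, y + t a * x + b), 1, ?_⟩
    have h1 := ht a
    have h2 := ht x
    rw [one_smul]
    ext i; fin_cases i
    · simp [titsVec, titsTranslation]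
    · simp [titsVec, titsTranslation]
    · simp [titsVec, titsTranslation]
    · simp [titsVec, titsTranslation]; grind
    · simp [titsVec, titsTranslation]; grind

/-- If X ≠ 0, division by X² t(X)² leaves a sum of conjugate pairs, on which the character is
trivial, equal to 1, where it is -1. The form serves twice: at x = 0 it is the last coordinate of an
ovoid point, and in general it is the polar form of two ovoid points. -/
theorem tits_norm_eq_zero [Fintype F] {x X Y : F}
    (h : X * t Y ^ 2 + Y ^ 2 + X ^ 2 * t x ^ 2 + X * t X ^ 2 * x + X ^ 2 * t X ^ 2 = 0) :
    X = 0 ∧ Y = 0 := by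
  by_cases hX : X = 0
  · subst hX
    simpa using h
  · exfalso
    have htX : t X ≠ 0 := (map_ne_zero t).2 hX
    obtain ⟨D, hD⟩ : ∃ D, Y = D * (X * t X) := ⟨Y / (X * t X), by field_simp⟩
    obtain ⟨A, hA⟩ : ∃ A, x = A * X := ⟨x / X, by field_simp⟩
    have h1 : X ^ 2 * t X ^ 2 * (t D ^ 2 + D ^ 2 + (t A ^ 2 + A) + 1) = 0 := by
      rw [← h, hD, hA]
      simp only [map_mul]
      have := ht X
      grind
    have h2 : t D ^ 2 + D ^ 2 + (t A ^ 2 + A) = 1 := by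
      have := (mul_eq_zero.1 h1).resolve_left (by simp [hX])
      grind
    have h3 := congrArg asSign h2
    simp only [asSign_add, asSign_sq, asSign_map t ht, asSign_mul_self, asSign_one t ht] at h3
    norm_num at h3

theorem coordReverse_titsVec [Fintype F] (o : Option (F × F)) :
    ∃ o' : Option (F × F), ∃ c : F, coordReverse F (titsVec t o) = c • titsVec t o' := by
  rcases o with _ | ⟨x, y⟩
  · refine ⟨some (0, 0), 1, ?_⟩
    ext i; fin_cases i <;> simp [titsVec, coordReverse]
  -- The last coordinate w becomes the first one and is the normalising factor; it vanishes only at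
  -- U₁, which goes to U₅.
  · obtain ⟨w, hw⟩ : ∃ w, w = x * (x * t x ^ 2 + t y ^ 2) + y ^ 2 := ⟨_, rfl⟩
    by_cases h0 : w = 0
    · obtain ⟨rfl, rfl⟩ := tits_norm_eq_zero t ht (x := 0) (X := x) (Y := y)
        (by simp; rw [← h0, hw]; ring)
      refine ⟨none, 1, ?_⟩
      ext i; fin_cases i <;> simp [titsVec, coordReverse]
    · have htw : t w ≠ 0 := (map_ne_zero t).2 h0
      have h1 : t w = t x * (t x * x + y) + t y ^ 2 := by
        rw [hw]; simp [ht]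
      refine ⟨some ((x * t x ^ 2 + t y ^ 2) / w, y / w), w, ?_⟩
      ext i; fin_cases i
      · simp [titsVec, coordReverse, hw]
      · simp [titsVec, coordReverse]; field_simp
      · simp [titsVec, coordReverse]; field_simp
      · simp [titsVec, coordReverse, ht]; field_simp; rw [h1]; grind
      · simp [titsVec, coordReverse, ht]; field_simp; grind

end TitsVec

/-! ### Solution counts for the two types of hyperplane equation. -/

section Count

variable {F : Type*} [Field F]

theorem ncard_setOf_option {α : Type*} [Finite α] (P : Option α → Prop) [Decidable (P none)] :
    {o | P o}.ncard = {a | P (some a)}.ncard + if P none then 1 else 0 := by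
  have hinj := Option.some_injective α
  split_ifs with h
  · have : {o | P o} = insert none (some '' {a | P (some a)}) := by
      ext o; cases o <;> simp [h]
    rw [this, Set.ncard_insert_of_notMem (by simp), Set.ncard_image_of_injective _ hinj]
  · have : {o | P o} = some '' {a | P (some a)} := by
      ext o; cases o <;> simp [h]
    rw [this, Set.ncard_image_of_injective _ hinj, add_zero]

theorem ncard_setOf_eq_card_filter {α : Type*} [Fintype α] (P : α → Prop) [DecidablePred P] :
    {a | P a}.ncard = (Finset.univ.filter P).card := by
  rw [← Set.ncard_coe_finset]; congr; ext; simp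

variable [Fintype F] [CharP F 2] (t : F →+* F) (ht : ∀ x, t (t x) ^ 2 = x)
include ht

/-- Summing the character over y first leaves only the l with l + t(l a₄) = 0. These are l = 0,
which gives the main term, and l₀ = a₄ t(a₄)², which gives a Tits sum after rescaling x by t(a₄)².
-/
theorem ncard_zeros_of_four_eq_zero (a₁ a₂ a₄ : F) (h4 : a₄ ≠ 0) :
    ({p : F × F | a₁ + a₂ * p.1 + p.2 + a₄ * (p.1 * t p.1 ^ 2 + t p.2 ^ 2) = 0}.ncard : ℤ) =
      Fintype.card F + asSign (a₁ * (a₄ * t a₄ ^ 2)) * titsSum t (a₂ * a₄) := by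
  classical
  have hq : (Fintype.card F : ℤ) ≠ 0 := by simp
  apply mul_left_cancel₀ hq
  rw [ncard_setOf_eq_card_filter, card_mul_card_zeros]
  have hs4 : t a₄ ≠ 0 := (map_ne_zero t).2 h4
  set l₀ := a₄ * t a₄ ^ 2 with hl₀
  have hl₀' : l₀ ≠ 0 := mul_ne_zero h4 (pow_ne_zero _ hs4)
  have hzero : ∀ l, l + t (l * a₄) = 0 ↔ l = 0 ∨ l = l₀ := by
    intro l
    constructor
    · intro h
      by_cases hl : l = 0
      · exact Or.inl hl
      · right
        have htl : t l ≠ 0 := (map_ne_zero t).2 hl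
        have h1 : t l ^ 2 = l * a₄ := by
          have : l = t (l * a₄) := by grind
          conv_lhs => rw [this]
          exact ht _
        have h2 : t l * t a₄ = l := by rw [← map_mul]; grind
        have h3 : l * (l + l₀) = 0 := by rw [hl₀]; grind
        have := (mul_eq_zero.1 h3).resolve_left hl
        grind
    · rintro (rfl | rfl)
      · simp
      · rw [hl₀]
        simp only [map_mul, map_pow, ht]
        grind
  have hy : ∀ l x y, asSign (l * (a₁ + a₂ * x + y + a₄ * (x * t x ^ 2 + t y ^ 2))) =
      asSign (l * (a₁ + a₂ * x + a₄ * (x * t x ^ 2))) * asSign ((l + t (l * a₄)) * y) := by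
    intro l x y
    have h1 : asSign (l * a₄ * t y ^ 2) = asSign (t (l * a₄) * y) := by
      rw [← asSign_map t ht, map_mul, map_map_sq t ht]
    rw [add_mul l, asSign_add (l * y), ← h1, ← asSign_add, ← asSign_add]
    congr 1; ring
  simp only [Fintype.sum_prod_type, hy, ← Finset.mul_sum, sum_asSign_mul, hzero]
  simp only [← Finset.sum_mul]
  simp only [mul_ite, mul_zero]
  rw [← Finset.sum_filter]
  have h5 : (Finset.univ.filter fun u : F => u = 0 ∨ u = l₀) = {0, l₀} := by
    ext; simp
  rw [h5, Finset.sum_pair hl₀'.symm]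
  have h6 : ∑ x : F, asSign (l₀ * (a₁ + a₂ * x + a₄ * (x * t x ^ 2))) =
      asSign (a₁ * l₀) * titsSum t (a₂ * a₄) := by
    have h7 : t a₄ ^ 2 ≠ 0 := pow_ne_zero _ hs4
    rw [titsSum, Finset.mul_sum, ← Equiv.sum_comp (Equiv.mulLeft₀ _ h7)
      (fun x => asSign (a₁ * l₀) * asSign (x * t x ^ 2 + a₂ * a₄ * x))]
    refine Finset.sum_congr rfl fun x _ => ?_
    rw [← asSign_add]
    congr 1
    simp only [Equiv.mulLeft₀_apply, map_mul, map_pow, hl₀]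
    have := ht a₄
    grind
  rw [h6]
  simp
  ring

/-- For each l ≠ 0 the sum over y singles out one x. There the argument of the character is, up to
conjugation, the Tits form at e² l plus 1. The summand 1 gives the minus sign, and the absent term l
= 0 of the Tits sum gives the + 1. -/
theorem ncard_zeros_of_five_eq_one (a₁ a₂ e : F) (he : e ≠ 0) :
    ∃ b, asSign b = asSign (a₁ / e ^ 2) ∧
    ({p : F × F | a₁ + a₂ * p.1 + e * p.2 +
      (p.1 * (p.1 * t p.1 ^ 2 + t p.2 ^ 2) + p.2 ^ 2) = 0}.ncard : ℤ) =
      Fintype.card F + 1 - titsSum t b := by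
  classical
  -- This is the coefficient of e² l once the terms in a₂ are conjugated so as to be linear in l. It
  -- differs from a₁ / e² by an element of the form u² + u.
  refine ⟨(a₁ + t a₂ * e + t a₂ ^ 2) / e ^ 2, ?_, ?_⟩
  · have h1 : (a₁ + t a₂ * e + t a₂ ^ 2) / e ^ 2 = a₁ / e ^ 2 + ((t a₂ / e) ^ 2 + t a₂ / e) := by
      field_simp; ring
    rw [h1, asSign_add, (asSign_eq_one_iff _).2 ⟨_, rfl⟩, mul_one]
  have hq : (Fintype.card F : ℤ) ≠ 0 := by simp
  apply mul_left_cancel₀ hq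
  rw [ncard_setOf_eq_card_filter, card_mul_card_zeros]
  have hy : ∀ l x y, asSign (l * (a₁ + a₂ * x + e * y + (x * (x * t x ^ 2 + t y ^ 2) + y ^ 2))) =
      asSign (l * (a₁ + a₂ * x + x ^ 2 * t x ^ 2)) *
        asSign ((l * e + t (l * x) + t (t l)) * y) := by
    intro l x y
    have h1 : asSign (l * x * t y ^ 2) = asSign (t (l * x) * y) := by
      rw [← asSign_map t ht, map_mul, map_map_sq t ht]
    have h2 : asSign (l * y ^ 2) = asSign (t (t l) * y) := by
      rw [← asSign_sq (t (t l) * y), mul_pow, ht]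
    rw [add_mul _ _ y, add_mul _ _ y, asSign_add (_ + _) (t (t l) * y),
      asSign_add _ (t (l * x) * y), ← h1, ← h2, ← asSign_add, ← asSign_add, ← asSign_add]
    congr 1; ring
  have hzero : ∀ l x, l ≠ 0 → (l * e + t (l * x) + t (t l) = 0 ↔ x = (t (l * e) ^ 2 + t l) / l) := by
    intro l x hl
    have htl : t l ≠ 0 := (map_ne_zero t).2 hl
    rw [eq_div_iff hl]
    constructor
    · intro h
      have h1 : t (l * x) = l * e + t (t l) := by grind
      have h2 := congrArg (fun z => t z ^ 2) h1
      simp only [ht, map_add] at h2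
      have := ht (t l)
      grind
    · intro h
      have h1 : l * x = t (l * e) ^ 2 + t l := by rw [mul_comm, h]
      rw [h1, map_add, map_pow, ht]
      grind
  simp only [Fintype.sum_prod_type, hy, ← Finset.mul_sum, sum_asSign_mul]
  rw [← Finset.add_sum_erase _ _ (Finset.mem_univ (0 : F))]
  have h3 : ∑ x : F, asSign (0 * (a₁ + a₂ * x + x ^ 2 * t x ^ 2)) *
      (if 0 * e + t (0 * x) + t (t 0) = 0 then (Fintype.card F : ℤ) else 0) =
      (Fintype.card F : ℤ) * Fintype.card F := by simp
  have h4 : ∀ l ∈ Finset.univ.erase (0 : F), (∑ x : F, asSign (l * (a₁ + a₂ * x + x ^ 2 * t x ^ 2)) *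
      (if l * e + t (l * x) + t (t l) = 0 then (Fintype.card F : ℤ) else 0)) =
      -(Fintype.card F : ℤ) * asSign (e ^ 2 * l * t (e ^ 2 * l) ^ 2 +
        (a₁ + t a₂ * e + t a₂ ^ 2) / e ^ 2 * (e ^ 2 * l)) := by
    intro l hl
    have hl : l ≠ 0 := by simpa using hl
    have htl : t l ≠ 0 := (map_ne_zero t).2 hl
    simp only [hzero l _ hl, mul_ite, mul_zero, Finset.sum_ite_eq', Finset.mem_univ, if_true]
    rw [mul_comm (asSign _), neg_mul, ← mul_neg]
    congr 1
    set x := (t (l * e) ^ 2 + t l) / l with hx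
    have hlx : l * x = t (l * e) ^ 2 + t l := by rw [hx]; field_simp
    have hsx : t l ^ 2 * t x ^ 2 = l ^ 2 * e ^ 2 + l := by
      rw [← mul_pow, ← map_mul, hlx, map_add, map_pow, ht]
      have := ht l
      grind
    have hm : l * (x ^ 2 * t x ^ 2) =
        l * t l ^ 2 * t e ^ 4 * e ^ 2 + (t (l * e ^ 2) ^ 2 + l * e ^ 2) + 1 := by
      have h1 : l * t l ^ 2 ≠ 0 := mul_ne_zero hl (pow_ne_zero _ htl)
      apply mul_left_cancel₀ h1
      have h2 : l * t l ^ 2 * (l * (x ^ 2 * t x ^ 2)) = (l * x) ^ 2 * (t l ^ 2 * t x ^ 2) := by ring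
      rw [h2, hlx, hsx]
      simp only [map_mul, map_pow]
      grind
    have h5 : asSign (a₂ * t (l * e) ^ 2) = asSign (t a₂ * (l * e)) := by
      rw [← asSign_map t ht, map_mul, map_map_sq t ht]
    have h6 : asSign (a₂ * t l) = asSign (t a₂ ^ 2 * l) := by
      rw [← asSign_sq, mul_pow, ← asSign_map t ht, map_mul, map_map_sq t ht, map_pow]
    have h7 : l * (a₁ + a₂ * x + x ^ 2 * t x ^ 2) =
        (l * a₁ + l * t l ^ 2 * t e ^ 4 * e ^ 2) + a₂ * t (l * e) ^ 2 + a₂ * t l +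
          (t (l * e ^ 2) ^ 2 + l * e ^ 2) + 1 := by
      linear_combination a₂ * hlx + hm
    rw [h7]
    simp only [asSign_add _ (1 : F), asSign_add _ (t (l * e ^ 2) ^ 2 + l * e ^ 2),
      asSign_add _ (a₂ * t l), asSign_add _ (a₂ * t (l * e) ^ 2), h5, h6, asSign_one t ht]
    rw [asSign_add (t (l * e ^ 2) ^ 2), asSign_sq, asSign_map t ht, asSign_mul_self, mul_one,
      mul_neg_one, neg_inj, ← asSign_add, ← asSign_add]
    congr 1
    simp only [map_mul, map_pow]
    field_simp
    ring
  rw [h3, Finset.sum_congr rfl h4, ← Finset.mul_sum]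
  have h5 : ∑ l ∈ Finset.univ.erase (0 : F), asSign (e ^ 2 * l * t (e ^ 2 * l) ^ 2 +
        (a₁ + t a₂ * e + t a₂ ^ 2) / e ^ 2 * (e ^ 2 * l)) =
      titsSum t ((a₁ + t a₂ * e + t a₂ ^ 2) / e ^ 2) - 1 := by
    rw [titsSum, ← Equiv.sum_comp (Equiv.mulLeft₀ _ (pow_ne_zero 2 he))
      (fun x => asSign (x * t x ^ 2 + (a₁ + t a₂ * e + t a₂ ^ 2) / e ^ 2 * x)),
      ← Finset.add_sum_erase _ _ (Finset.mem_univ (0 : F))]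
    simp
  rw [h5]
  ring

end Count

/-! ### Intersection of the ovoid with an elliptic hyperplane; a root bound. -/

section Intersection

variable {F : Type*} [Field F] [Fintype F] [CharP F 2] (t : F →+* F)
  (ht : ∀ x, t (t x) ^ 2 = x)
include ht

theorem ncard_titsVec_of_four_eq_zero (φ : (Fin 5 → F) →ₗ[F] F) (h2 : φ (Pi.single 2 1) = 1)
    (h4 : φ (Pi.single 4 1) = 0) (h3 : φ (Pi.single 3 1) ≠ 0) :
    ({o | φ (titsVec t o) = 0}.ncard : ℤ) = Fintype.card F + 1 +
      asSign (φ (Pi.single 0 1) * (φ (Pi.single 3 1) * t (φ (Pi.single 3 1)) ^ 2)) *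
        titsSum t (φ (Pi.single 1 1) * φ (Pi.single 3 1)) := by
  classical
  rw [ncard_setOf_option]
  have h := ncard_zeros_of_four_eq_zero t ht (φ (Pi.single 0 1)) (φ (Pi.single 1 1))
    (φ (Pi.single 3 1)) h3
  rw [linearForm_titsVec_none, h4, if_pos rfl]
  have h5 : {a : F × F | φ (titsVec t (some a)) = 0} = {p : F × F | φ (Pi.single 0 1) +
      φ (Pi.single 1 1) * p.1 + p.2 + φ (Pi.single 3 1) * (p.1 * t p.1 ^ 2 + t p.2 ^ 2) = 0} := by
    ext ⟨x, y⟩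
    simp only [Set.mem_ofPred_eq, linearForm_titsVec_some, h2, h4, zero_mul, add_zero, one_mul]
  rw [h5]
  push_cast
  rw [h]
  ring

/-- The argument of `asSign` is an Arf invariant of the section, unchanged by scaling φ. If φ(U₅) =
0, the first count applies. Otherwise φ is scaled to φ(U₅) = 1, and the translation with parameters
a = φ(U₄) and 0 kills the coefficient of X₄, which leads to the second count. -/
theorem exists_ncard_titsVec_eq (φ : (Fin 5 → F) →ₗ[F] F) (h2 : φ (Pi.single 2 1) ≠ 0)
    (hs : asSign ((φ (Pi.single 0 1) * φ (Pi.single 4 1) + φ (Pi.single 1 1) * φ (Pi.single 3 1)) /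
      φ (Pi.single 2 1) ^ 2) = -1) :
    ∃ S : ℤ, S ^ 2 = 2 * (Fintype.card F : ℤ) ∧
      ({o | φ (titsVec t o) = 0}.ncard : ℤ) = Fintype.card F + 1 + S := by
  classical
  have hscale : ∀ (c : F), c ≠ 0 →
      {o | φ (titsVec t o) = 0} = {o | (c • φ) (titsVec t o) = 0} := by
    intro c hc; ext o; simp [hc]
  by_cases h4 : φ (Pi.single 4 1) = 0
  · have h3 : φ (Pi.single 3 1) ≠ 0 := by
      intro h3
      simp [h3, h4] at hs
    rw [hscale _ (inv_ne_zero h2)]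
    refine ⟨_, ?_, ncard_titsVec_of_four_eq_zero t ht _ ?_ ?_ ?_⟩
    · rw [mul_pow, titsSum_sq t ht, sq, asSign_mul_self, one_mul]
      rw [← hs, h4]
      congr 1
      simp
      field_simp
    · simp [h2]
    · simp [h4]
    · simp [h2, h3]
  · rw [hscale _ (inv_ne_zero h4)]
    set ψ := (φ (Pi.single 4 1))⁻¹ • φ with hψ
    have hψ4 : ψ (Pi.single 4 1) = 1 := by simp [hψ, h4]
    have hψ2 : ψ (Pi.single 2 1) ≠ 0 := by simp [hψ, h4, h2]
    have hψs : asSign ((ψ (Pi.single 0 1) + ψ (Pi.single 1 1) * ψ (Pi.single 3 1)) /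
        ψ (Pi.single 2 1) ^ 2) = -1 := by
      rw [← hs]
      congr 1
      simp [hψ]
      field_simp
    clear_value ψ
    set a := ψ (Pi.single 3 1) with ha
    rw [← ncard_titsVec_comp t (titsTranslation t a 0) (titsTranslation_injective t a 0)
      (titsTranslation_titsVec t ht a 0) (fun v => ψ v = 0) (fun v c hc => by simp [hc])]
    have e4 : ψ (titsTranslation t a 0 (Pi.single 4 1)) = 1 := by
      rw [titsTranslation_single_four, hψ4]
    have e3 : ψ (titsTranslation t a 0 (Pi.single 3 1)) = 0 := by
      rw [titsTranslation_single_three, linearForm_apply, ← ha, hψ4]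
      simp; grind
    have e2 : ψ (titsTranslation t a 0 (Pi.single 2 1)) = ψ (Pi.single 2 1) := by
      rw [titsTranslation_single_two]
    have e0 : ψ (titsTranslation t a 0 (Pi.single 0 1)) =
        ψ (Pi.single 0 1) + ψ (Pi.single 1 1) * a := by
      rw [titsTranslation_single_zero, linearForm_titsVec_some, ← ha, hψ4]
      simp; grind
    obtain ⟨b, hb, hcount⟩ := ncard_zeros_of_five_eq_one t ht
      (ψ (Pi.single 0 1) + ψ (Pi.single 1 1) * a)
      (ψ (titsTranslation t a 0 (Pi.single 1 1))) (ψ (Pi.single 2 1)) hψ2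
    refine ⟨-titsSum t b, ?_, ?_⟩
    · rw [neg_sq, titsSum_sq t ht b (hb.trans hψs)]
    · have hcomp : ∀ v, ψ (titsTranslation t a 0 v) = (ψ ∘ₗ titsTranslation t a 0) v :=
        fun v => rfl
      rw [ncard_setOf_option]
      have hnone : ψ (titsTranslation t a 0 (titsVec t none)) ≠ 0 := by
        rw [hcomp, linearForm_titsVec_none, LinearMap.comp_apply, e4]
        exact one_ne_zero
      rw [if_neg hnone, add_zero]
      have h5 : {p : F × F | ψ (titsTranslation t a 0 (titsVec t (some p))) = 0} =
          {p : F × F | ψ (Pi.single 0 1) + ψ (Pi.single 1 1) * a +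
            ψ (titsTranslation t a 0 (Pi.single 1 1)) * p.1 + ψ (Pi.single 2 1) * p.2 +
            (p.1 * (p.1 * t p.1 ^ 2 + t p.2 ^ 2) + p.2 ^ 2) = 0} := by
        ext ⟨x, y⟩
        rw [Set.mem_ofPred_eq, hcomp, linearForm_titsVec_some]
        simp only [LinearMap.comp_apply, e4, e3, e2, e0]
        simp
      rw [h5, hcount]
      ring

-- The degree is 2^(r+1) if C ≠ 0. If C = 0 it is at most 2^r, and 2^r + 1 ≤ 2^(r+1) leaves room for
-- the extra unit, which stands for a root at infinity.
omit ht [CharP F 2] [Fintype F] in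
theorem ncard_quadrinomial_roots_le (r : ℕ) (hr : 1 ≤ r) (hpow : ∀ x, t x = x ^ 2 ^ r)
    (C A D : F) [Decidable (C = 0)] :
    {v | C * t v ^ 2 + t v + A * v + D = 0}.ncard + (if C = 0 then 1 else 0) ≤ 2 ^ (r + 1) := by
  classical
  open Polynomial in
  set p : F[X] := Polynomial.C C * X ^ 2 ^ (r + 1) + X ^ 2 ^ r + Polynomial.C A * X +
    Polynomial.C D with hp
  have h1 : 2 ≤ 2 ^ r := by
    calc 2 = 2 ^ 1 := rfl
      _ ≤ 2 ^ r := Nat.pow_le_pow_right (by norm_num) hr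
  have h2 : 2 ^ (r + 1) = 2 * 2 ^ r := by ring
  -- This coefficient makes p nonzero whatever C, A and D are; it does not mix with A because 2^r ≠
  -- 1.
  have hcoeff : p.coeff (2 ^ r) = 1 := by
    rw [hp]
    simp only [Polynomial.coeff_add, Polynomial.coeff_C_mul, Polynomial.coeff_X_pow,
      Polynomial.coeff_X, Polynomial.coeff_C]
    have n1 : 2 ^ r ≠ 2 ^ (r + 1) := by omega
    have n2 : 1 ≠ 2 ^ r := by omega
    simp [n1, n2]
  have hp0 : p ≠ 0 := fun h => by simp [h] at hcoeff
  have hset : {v | C * t v ^ 2 + t v + A * v + D = 0} ⊆ (p.roots.toFinset : Set F) := by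
    intro v hv
    rw [Finset.mem_coe, Multiset.mem_toFinset, Polynomial.mem_roots hp0, Polynomial.IsRoot.def, hp]
    simp only [Polynomial.eval_add, Polynomial.eval_mul, Polynomial.eval_C, Polynomial.eval_pow,
      Polynomial.eval_X]
    rw [Set.mem_ofPred_eq, hpow] at hv
    rw [← hv, pow_succ 2 r, pow_mul]
  have hle : {v | C * t v ^ 2 + t v + A * v + D = 0}.ncard ≤ p.natDegree := by
    calc _ ≤ (p.roots.toFinset : Set F).ncard := Set.ncard_le_ncard hset (Finset.finite_toSet _)
      _ = p.roots.toFinset.card := Set.ncard_coe_finset _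
      _ ≤ Multiset.card p.roots := Multiset.toFinset_card_le _
      _ ≤ p.natDegree := Polynomial.card_roots' p
  have hdX : (Polynomial.C A * Polynomial.X + Polynomial.C D).natDegree ≤ 2 ^ r :=
    Polynomial.natDegree_linear_le.trans (by omega)
  have hdXr : (Polynomial.X ^ 2 ^ r + Polynomial.C A * Polynomial.X +
      Polynomial.C D).natDegree ≤ 2 ^ r := by
    rw [add_assoc]
    exact Polynomial.natDegree_add_le_of_degree_le (Polynomial.natDegree_X_pow_le _) hdX
  split_ifs with hC
  · have : p.natDegree ≤ 2 ^ r := by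
      rw [hp, hC, map_zero, zero_mul, zero_add]
      exact hdXr
    omega
  · have : p.natDegree ≤ 2 ^ (r + 1) := by
      rw [hp, add_assoc, add_assoc]
      refine Polynomial.natDegree_add_le_of_degree_le (Polynomial.natDegree_C_mul_X_pow_le _ _) ?_
      rw [← add_assoc]
      omega
    omega

end Intersection

/-! ### Bounds for hyperplanes through the nucleus. -/

section Bound

variable {F : Type*} [Field F] [Fintype F] [CharP F 2] (t : F →+* F)
  (ht : ∀ x, t (t x) ^ 2 = x) (r : ℕ) (hr : 1 ≤ r) (hpow : ∀ x, t x = x ^ 2 ^ r)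

-- Applying σ to a^(σ+1) gives a^(σ+2), because σ² is squaring; for a ≠ 0 the quotient recovers a.
omit [Fintype F] [CharP F 2] in
theorem mul_sq_map_injective (ht : ∀ x, t (t x) ^ 2 = x) {a b : F}
    (h : a * t a ^ 2 = b * t b ^ 2) : a = b := by
  have h1 := congrArg (fun z => t z ^ 2) h
  simp only [map_mul, map_pow, ht] at h1
  by_cases ha : a = 0
  · subst ha
    exact (by simpa using h.symm : b = 0).symm
  · have hta : t a ≠ 0 := (map_ne_zero t).2 ha
    have hb : b ≠ 0 := by rintro rfl; simp [ha] at h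
    have htb : t b ≠ 0 := (map_ne_zero t).2 hb
    have h2 : a * (t a ^ 2 * a) * (b * t b ^ 2) = b * (t b ^ 2 * b) * (a * t a ^ 2) := by
      have h3 : t a ^ 2 * a ^ 2 = t b ^ 2 * b ^ 2 := by linear_combination h1
      linear_combination (b * t b ^ 2) * h3 - (t b ^ 2 * b ^ 2) * h
    have h4 : a * b * t a ^ 2 * t b ^ 2 ≠ 0 := by simp [ha, hb]
    apply mul_left_cancel₀ h4
    linear_combination h2

include ht hr hpow

omit [CharP F 2] ht in
theorem ncard_option_roots_le (C A D : F) :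
    {o : Option F | (o = none → C = 0) ∧
      ∀ v, o = some v → C * t v ^ 2 + t v + A * v + D = 0}.ncard ≤ 2 ^ (r + 1) := by
  classical
  rw [ncard_setOf_option]
  simpa using ncard_quadrinomial_roots_le t r hr hpow C A D

/-- Case of the bound where the second hyperplane contains `U₅` but not `U₄`. -/
theorem ncard_titsVec_section_le_aux (a₁ a₂ a₄ a₅ A₀ B : F) :
    {o | (∀ x y, o = some (x, y) →
        a₁ + a₂ * x + y + a₄ * (x * t x ^ 2 + t y ^ 2) +
          a₅ * (x * (x * t x ^ 2 + t y ^ 2) + y ^ 2) = 0 ∧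
        x * t x ^ 2 + t y ^ 2 = t A₀ ^ 2 + t B ^ 2 * x) ∧ (o = none → a₅ = 0)}.ncard ≤
      2 ^ (r + 1) := by
  classical
  set α := t A₀ ^ 2
  set β := t B ^ 2
  have hαt : t α = A₀ := map_map_sq t ht A₀
  have hβt : t β = B := map_map_sq t ht B
  refine le_trans ?_ (ncard_option_roots_le t r hr hpow
    (A₀ + a₁ + a₂ * B + a₄ * (α + β * B) + a₅ * (A₀ ^ 2 + B * α + B ^ 2 * β))
    (t B + a₂ + a₄ * β + a₅ * α) a₅)
  have hy : ∀ x y, x * t x ^ 2 + t y ^ 2 = α + β * x → y = A₀ + B * t x + x * t x := by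
    intro x y h
    have h1 := congrArg t h
    simp only [map_add, map_mul, map_pow, ht, hαt, hβt] at h1
    have := map_map_sq t ht x
    grind
  -- With y eliminated and s = x + B, the first equation has terms 1, s, s t(s) and (s t(s))².
  -- Dividing by (s t(s))² makes it a quadrinomial in v = 1/(s t(s)²), since t(v) = 1/(s t(s)). The
  -- point U₅ goes to v = 0, and s = 0 to the root at infinity.
  refine Set.ncard_le_ncard_of_injOn (fun o => match o with
    | none => some 0
    | some (x, _) => if x + B = 0 then none else
      some (((x + B) * t (x + B) ^ 2)⁻¹)) ?_ ?_ (Set.toFinite _)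
  · rintro (_ | ⟨x, y⟩) ⟨h1, h2⟩
    · simp [h2 rfl]
    · obtain ⟨h3, h4⟩ := h1 x y rfl
      have h5 := hy x y h4
      obtain ⟨s, hs⟩ : ∃ s, s = x + B := ⟨_, rfl⟩
      have hx : x = s + B := by grind
      have key : (A₀ + a₁ + a₂ * B + a₄ * (α + β * B) + a₅ * (A₀ ^ 2 + B * α + B ^ 2 * β)) +
          s * t s + (t B + a₂ + a₄ * β + a₅ * α) * s + a₅ * (s * t s) ^ 2 = 0 := by
        rw [h4] at h3
        rw [h5, hx, map_add] at h3
        have hβ : t B ^ 2 = β := rfl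
        grind
      by_cases h0 : s = 0
      · have hs0 : x + B = 0 := by rw [← hs, h0]
        simp only [hs0, if_true]
        refine ⟨fun _ => ?_, by simp⟩
        rw [h0] at key
        simpa using key
      · have hts : t s ≠ 0 := (map_ne_zero t).2 h0
        simp only [← hs, h0, if_false]
        refine ⟨by simp, fun v hv => ?_⟩
        rw [← Option.some.inj hv, map_inv₀, map_mul, map_map_sq t ht]
        field_simp
        linear_combination key
  · rintro (_ | ⟨x, y⟩) ⟨h1, h2⟩ (_ | ⟨x', y'⟩) ⟨h1', h2'⟩ h
    · rfl
    · exfalso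
      simp only at h
      split_ifs at h with h0
      have h0' : t (x' + B) ≠ 0 := (map_ne_zero t).2 h0
      have := Option.some.inj h
      exact inv_ne_zero (mul_ne_zero h0 (pow_ne_zero 2 h0')) this.symm
    · exfalso
      simp only at h
      split_ifs at h with h0
      have h0' : t (x + B) ≠ 0 := (map_ne_zero t).2 h0
      have := Option.some.inj h
      exact inv_ne_zero (mul_ne_zero h0 (pow_ne_zero 2 h0')) this
    · have hxx : x = x' := by
        simp only at h
        split_ifs at h with h0 h0' h0'
        · grind
        · have := inv_injective (Option.some.inj h)
          exact add_right_cancel (mul_sq_map_injective t ht this)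
      subst hxx
      rw [hy x y (h1 x y rfl).2, hy x y' (h1' x y' rfl).2]

/-- Case of the bound where the second hyperplane contains `U₄` and `U₅`. -/
theorem ncard_titsVec_section_le_aux' (a₁ a₂ a₄ a₅ B : F) :
    {o | (∀ x y, o = some (x, y) →
        a₁ + a₂ * x + y + a₄ * (x * t x ^ 2 + t y ^ 2) +
          a₅ * (x * (x * t x ^ 2 + t y ^ 2) + y ^ 2) = 0 ∧
        x = B) ∧ (o = none → a₅ = 0)}.ncard ≤
      2 ^ (r + 1) := by
  -- With x = B fixed, applying t to the first equation turns y^σ into y, y into t(y) and y² into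
  -- t(y)². Here U₅ is the root at infinity.
  refine le_trans ?_ (ncard_option_roots_le t r hr hpow (t a₅) (t a₄ + t a₅ * t B)
    (t (a₁ + a₂ * B + a₄ * (B * t B ^ 2) + a₅ * (B * (B * t B ^ 2)))))
  refine Set.ncard_le_ncard_of_injOn (Option.map Prod.snd) ?_ ?_ (Set.toFinite _)
  · rintro (_ | ⟨x, y⟩) ⟨h1, h2⟩
    · simp [h2 rfl]
    · obtain ⟨h3, rfl⟩ := h1 x y rfl
      refine ⟨by simp, fun v hv => ?_⟩
      obtain rfl : y = v := by simpa using hv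
      have h4 := congrArg t h3
      rw [map_zero] at h4
      rw [← h4]
      have := map_map_sq t ht y
      simp only [map_add, map_mul, this, map_pow, ht]
      grind
  · rintro (_ | ⟨x, y⟩) ⟨h1, h2⟩ (_ | ⟨x', y'⟩) ⟨h1', h2'⟩ h
    · rfl
    · simp at h
    · simp at h
    · obtain ⟨-, rfl⟩ := h1 x y rfl
      obtain ⟨-, rfl⟩ := h1' x' y' rfl
      simpa using h

theorem ncard_titsVec_section_le_of_four_eq_zero (φ ψ : (Fin 5 → F) →ₗ[F] F)
    (hφ : φ (Pi.single 2 1) = 1) (h2 : ψ (Pi.single 2 1) = 0) (h4 : ψ (Pi.single 4 1) = 0)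
    (hψ : ψ ≠ 0) :
    {o | φ (titsVec t o) = 0 ∧ ψ (titsVec t o) = 0}.ncard ≤ 2 ^ (r + 1) := by
  by_cases h3 : ψ (Pi.single 3 1) = 0
  · by_cases h1 : ψ (Pi.single 1 1) = 0
    · have h0 : ψ (Pi.single 0 1) ≠ 0 := by
        intro h0
        apply hψ
        refine LinearMap.ext fun v => ?_
        rw [linearForm_apply, h0, h1, h2, h3, h4]
        simp
      have : {o | φ (titsVec t o) = 0 ∧ ψ (titsVec t o) = 0} ⊆ {none} := by
        rintro (_ | ⟨x, y⟩) ⟨-, h⟩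
        · rfl
        · rw [linearForm_titsVec_some, h1, h2, h3, h4] at h
          simp [h0] at h
      refine (Set.ncard_le_ncard this).trans ?_
      rw [Set.ncard_singleton]
      exact Nat.one_le_two_pow
    · refine le_trans (Set.ncard_le_ncard ?_ (Set.toFinite _)) (ncard_titsVec_section_le_aux' t ht r hr hpow
        (φ (Pi.single 0 1)) (φ (Pi.single 1 1)) (φ (Pi.single 3 1)) (φ (Pi.single 4 1))
        (-(ψ (Pi.single 0 1)) / ψ (Pi.single 1 1)))
      rintro o ⟨h5, h6⟩
      refine ⟨?_, ?_⟩
      · rintro x y rfl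
        rw [linearForm_titsVec_some, h2, h3, h4] at h6
        rw [linearForm_titsVec_some, hφ, one_mul] at h5
        refine ⟨h5, ?_⟩
        rw [eq_div_iff h1]
        linear_combination h6
      · rintro rfl
        rwa [linearForm_titsVec_none] at h5
  · have hs : ∀ z, t (t z) ^ 2 = z := ht
    refine le_trans (Set.ncard_le_ncard ?_ (Set.toFinite _)) (ncard_titsVec_section_le_aux t ht r hr hpow
      (φ (Pi.single 0 1)) (φ (Pi.single 1 1)) (φ (Pi.single 3 1)) (φ (Pi.single 4 1))
      (t (-(ψ (Pi.single 0 1)) / ψ (Pi.single 3 1))) (t (-(ψ (Pi.single 1 1)) / ψ (Pi.single 3 1))))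
    rintro o ⟨h5, h6⟩
    refine ⟨?_, ?_⟩
    · rintro x y rfl
      rw [linearForm_titsVec_some, h2, h4] at h6
      rw [linearForm_titsVec_some, hφ, one_mul] at h5
      refine ⟨h5, ?_⟩
      rw [hs, hs]
      field_simp
      linear_combination h6
    · rintro rfl
      rwa [linearForm_titsVec_none] at h5

-- A linear equation determines a. With this a the terms in t(b)² cancel in the value at the image
-- of U₁, so b is found by extracting a square root. After coordinate reversal, the second vanishing
-- places U₅ on the hyperplane.
omit hr hpow [Fintype F] in
theorem exists_titsTranslation (ψ : (Fin 5 → F) →ₗ[F] F) (h4 : ψ (Pi.single 4 1) ≠ 0)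
    (h2 : ψ (Pi.single 2 1) = 0) :
    ∃ a b, ψ (titsTranslation t a b (Pi.single 3 1)) = 0 ∧
      ψ (titsTranslation t a b (Pi.single 0 1)) = 0 := by
  set c := ψ (Pi.single 4 1)
  obtain ⟨a, ha⟩ : ∃ a, ψ (Pi.single 3 1) = a * c := ⟨ψ (Pi.single 3 1) / c, by field_simp⟩
  obtain ⟨b, hb⟩ : ∃ b, b ^ 2 * c = ψ (Pi.single 0 1) + a * ψ (Pi.single 1 1) :=
    ⟨t (t ((ψ (Pi.single 0 1) + a * ψ (Pi.single 1 1)) / c)), by rw [ht]; field_simp⟩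
  refine ⟨a, b, ?_, ?_⟩
  · rw [titsTranslation_single_three, linearForm_apply, ha]
    simp
    grind
  · rw [titsTranslation_single_zero, linearForm_titsVec_some, ha, h2]
    grind

/-- A translation followed by the reversal reduces to the case where the second hyperplane contains
U₅. It then determines y from x, or fixes x, or meets the ovoid in U₅ at most; in the first two
cases a quadrinomial in one variable remains. -/
theorem ncard_titsVec_section_le (φ ψ : (Fin 5 → F) →ₗ[F] F)
    (hφ : φ (Pi.single 2 1) ≠ 0) (h2 : ψ (Pi.single 2 1) = 0) (hψ : ψ ≠ 0) :
    {o | φ (titsVec t o) = 0 ∧ ψ (titsVec t o) = 0}.ncard ≤ 2 ^ (r + 1) := by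
  have hset : {o | φ (titsVec t o) = 0 ∧ ψ (titsVec t o) = 0} =
      {o | ((φ (Pi.single 2 1))⁻¹ • φ) (titsVec t o) = 0 ∧ ψ (titsVec t o) = 0} := by
    ext o; simp [hφ]
  rw [hset]
  have hφ' : ((φ (Pi.single 2 1))⁻¹ • φ) (Pi.single 2 1) = 1 := by simp [hφ]
  generalize (φ (Pi.single 2 1))⁻¹ • φ = χ at hφ'
  by_cases h4 : ψ (Pi.single 4 1) = 0
  · exact ncard_titsVec_section_le_of_four_eq_zero t ht r hr hpow χ ψ hφ' h2 h4 hψ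
  · obtain ⟨a, b, h3', h0'⟩ := exists_titsTranslation t ht ψ h4 h2
    rw [← ncard_titsVec_comp t (titsTranslation t a b) (titsTranslation_injective t a b)
      (titsTranslation_titsVec t ht a b) (fun v => χ v = 0 ∧ ψ v = 0) (fun v c hc => by simp [hc]),
      ← ncard_titsVec_comp t (coordReverse F) coordReverse_injective
      (coordReverse_titsVec t ht) (fun v => χ (titsTranslation t a b v) = 0 ∧
        ψ (titsTranslation t a b v) = 0) (fun v c hc => by simp [hc])]
    refine ncard_titsVec_section_le_of_four_eq_zero t ht r hr hpow
      (χ ∘ₗ titsTranslation t a b ∘ₗ coordReverse F)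
      (ψ ∘ₗ titsTranslation t a b ∘ₗ coordReverse F) ?_ ?_ ?_ ?_
    · simp only [LinearMap.comp_apply, coordReverse_single]
      exact (congrArg χ (titsTranslation_single_two t a b)).trans hφ'
    · simp only [LinearMap.comp_apply, coordReverse_single]
      exact (congrArg ψ (titsTranslation_single_two t a b)).trans h2
    · simp only [LinearMap.comp_apply, coordReverse_single]
      exact h0'
    · intro h
      apply h4
      have := LinearMap.congr_fun h (Pi.single 0 1)
      simp only [LinearMap.comp_apply, coordReverse_single] at this
      exact (congrArg ψ (titsTranslation_single_four t a b)).symm.trans this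

omit hr hpow

/-- Besides U₅ there are q points, obtained by solving for x with y free, or for y with x free by
means of t as the inverse of σ. -/
theorem card_add_one_le_ncard_titsVec_of_four_eq_zero (ψ : (Fin 5 → F) →ₗ[F] F)
    (h2 : ψ (Pi.single 2 1) = 0) (h4 : ψ (Pi.single 4 1) = 0)
    (h13 : ψ (Pi.single 1 1) ≠ 0 ∨ ψ (Pi.single 3 1) ≠ 0) :
    Fintype.card F + 1 ≤ {o | ψ (titsVec t o) = 0}.ncard := by
  classical
  rw [ncard_setOf_option, if_pos (by rw [linearForm_titsVec_none, h4])]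
  refine Nat.add_le_add_right ?_ 1
  rw [← Nat.card_eq_fintype_card, ← Set.ncard_univ]
  by_cases h3 : ψ (Pi.single 3 1) = 0
  · have h1 := h13.resolve_right (not_not.2 h3)
    refine Set.ncard_le_ncard_of_injOn
      (fun y => (-(ψ (Pi.single 0 1)) / ψ (Pi.single 1 1), y)) ?_ ?_ (Set.toFinite _)
    · intro y _
      rw [Set.mem_ofPred_eq, linearForm_titsVec_some, h2, h3, h4]
      field_simp
      ring
    · intro y _ y' _ h
      simpa using h
  · refine Set.ncard_le_ncard_of_injOn
      (fun x => (x, t ((ψ (Pi.single 0 1) + ψ (Pi.single 1 1) * x) / ψ (Pi.single 3 1) +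
        x * t x ^ 2))) ?_ ?_ (Set.toFinite _)
    · intro x _
      rw [Set.mem_ofPred_eq, linearForm_titsVec_some, h2, h4, ht]
      field_simp
      grind
    · intro y _ y' _ h
      exact (Prod.mk.inj h).1

/-- A hyperplane through the nucleus that is not tangent to the canonical Suzuki–Tits ovoid meets
it in at least `q + 1` points. -/
theorem card_add_one_le_ncard_titsVec (ψ : (Fin 5 → F) →ₗ[F] F)
    (h2 : ψ (Pi.single 2 1) = 0) :
    Fintype.card F + 1 ≤ {o | ψ (titsVec t o) = 0}.ncard ∨
      ∃ o c, ψ (Pi.single 0 1) = c * titsVec t o 4 ∧ ψ (Pi.single 1 1) = c * titsVec t o 3 ∧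
        ψ (Pi.single 3 1) = c * titsVec t o 1 ∧ ψ (Pi.single 4 1) = c * titsVec t o 0 := by
  by_cases h4 : ψ (Pi.single 4 1) = 0
  · by_cases h13 : ψ (Pi.single 1 1) ≠ 0 ∨ ψ (Pi.single 3 1) ≠ 0
    · exact Or.inl (card_add_one_le_ncard_titsVec_of_four_eq_zero t ht ψ h2 h4 h13)
    · push Not at h13
      exact Or.inr ⟨none, ψ (Pi.single 0 1), by simp [titsVec, h13, h4]⟩
  · obtain ⟨a, b, h3', h0'⟩ := exists_titsTranslation t ht ψ h4 h2
    -- If this coefficient vanishes too, only that of X₅ survives. The translated hyperplane is then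
    -- tangent at U₁, hence the original one is tangent at the point with parameters a, b.
    by_cases h1' : ψ (titsTranslation t a b (Pi.single 1 1)) = 0
    · right
      refine ⟨some (a, b), ψ (Pi.single 4 1), ?_⟩
      rw [titsTranslation_single_zero, linearForm_titsVec_some, h2] at h0'
      rw [titsTranslation_single_three, linearForm_apply] at h3'
      rw [titsTranslation_single_one, linearForm_apply, h2] at h1'
      simp at h3' h1'
      simp [titsVec]
      grind
    · left
      rw [← ncard_titsVec_comp t (titsTranslation t a b) (titsTranslation_injective t a b)
        (titsTranslation_titsVec t ht a b) (fun v => ψ v = 0) (fun v c hc => by simp [hc]),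
        ← ncard_titsVec_comp t (coordReverse F) coordReverse_injective
        (coordReverse_titsVec t ht) (fun v => ψ (titsTranslation t a b v) = 0)
        (fun v c hc => by simp [hc])]
      refine card_add_one_le_ncard_titsVec_of_four_eq_zero t ht
        (ψ ∘ₗ titsTranslation t a b ∘ₗ coordReverse F) ?_ ?_ (Or.inr ?_)
      · simp only [LinearMap.comp_apply, coordReverse_single]
        exact (congrArg ψ (titsTranslation_single_two t a b)).trans h2
      · simp only [LinearMap.comp_apply, coordReverse_single]
        exact h0'
      · simp only [LinearMap.comp_apply, coordReverse_single]
        exact h1'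

end Bound

/-! ### Hyperplanes containing no line of the quadric. -/

section Quadric

variable {F : Type*} [Field F]

theorem parabolicForm_apply (v : Fin 5 → F) :
    parabolicForm F v = v 0 * v 4 + v 1 * v 3 + v 2 * v 2 := by
  simp [parabolicForm]

/-- The alternating polar form of `parabolicForm` in characteristic two. -/
def parabolicPolar (u : Fin 5 → F) : (Fin 5 → F) →ₗ[F] F where
  toFun v := u 0 * v 4 + u 4 * v 0 + u 1 * v 3 + u 3 * v 1
  map_add' v w := by simp; ring
  map_smul' c v := by simp; ring

theorem parabolicPolar_apply (u v : Fin 5 → F) :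
    parabolicPolar u v = u 0 * v 4 + u 4 * v 0 + u 1 * v 3 + u 3 * v 1 := rfl

theorem parabolicForm_smul (c : F) (v : Fin 5 → F) :
    parabolicForm F (c • v) = c ^ 2 * parabolicForm F v := by
  simp only [parabolicForm_apply, Pi.smul_apply, smul_eq_mul]; ring

/-- A hyperplane, given by a linear form, that contains no line of the parabolic quadric. -/
def NoSingularLine (φ : (Fin 5 → F) →ₗ[F] F) : Prop :=
  ∀ u v, φ u = 0 → φ v = 0 → parabolicForm F u = 0 → parabolicForm F v = 0 →
    parabolicForm F (u + v) = 0 → u ≠ 0 → ∃ c : F, v = c • u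

theorem NoSingularLine.smul {φ : (Fin 5 → F) →ₗ[F] F} (h : NoSingularLine φ) {c : F}
    (hc : c ≠ 0) : NoSingularLine (c • φ) := by
  intro u v hu hv
  exact h u v (by simpa [hc] using hu) (by simpa [hc] using hv)

theorem NoSingularLine.comp {φ : (Fin 5 → F) →ₗ[F] F} (h : NoSingularLine φ)
    (g : (Fin 5 → F) →ₗ[F] (Fin 5 → F)) (hg : Function.Injective g)
    (hQ : ∀ v, parabolicForm F v = 0 → parabolicForm F (g v) = 0) : NoSingularLine (φ ∘ₗ g) := by
  intro u v hu hv h1 h2 h3 h0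
  obtain ⟨c, hc⟩ := h (g u) (g v) hu hv (hQ _ h1) (hQ _ h2) (by rw [← map_add]; exact hQ _ h3)
    (fun h => h0 (hg (by rw [h, map_zero])))
  exact ⟨c, hg (by rw [hc, map_smul])⟩

variable [CharP F 2]

theorem parabolicForm_add (u v : Fin 5 → F) :
    parabolicForm F (u + v) = parabolicForm F u + parabolicForm F v + parabolicPolar u v := by
  simp only [parabolicForm_apply, parabolicPolar_apply, Pi.add_apply]; grind

theorem parabolicForm_lincomb {u v : Fin 5 → F} (hu : parabolicForm F u = 0)
    (hv : parabolicForm F v = 0) (h : parabolicPolar u v = 0) (a b : F) :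
    parabolicForm F (a • u + b • v) = 0 := by
  rw [parabolicForm_add, parabolicForm_smul, parabolicForm_smul, hu, hv]
  rw [parabolicPolar_apply] at *
  simp only [Pi.smul_apply, smul_eq_mul]
  linear_combination a * b * h

variable (t : F →+* F) (ht : ∀ x, t (t x) ^ 2 = x)
include ht

/-- Otherwise φ is the polar form of a singular vector P. Each v in the kernel becomes singular
after adding a multiple of the nucleus, and is orthogonal to P, hence is then a multiple of P. The
kernel would have dimension at most 2 instead of at least 4. -/
theorem NoSingularLine.apply_nucleus_ne_zero {φ : (Fin 5 → F) →ₗ[F] F} (h : NoSingularLine φ) :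
    φ (Pi.single 2 1) ≠ 0 := by
  intro h2
  obtain ⟨p, hp⟩ : ∃ p, p ^ 2 = φ (Pi.single 4 1) * φ (Pi.single 0 1) +
    φ (Pi.single 3 1) * φ (Pi.single 1 1) := ⟨_, ht _⟩
  set P : Fin 5 → F := ![φ (Pi.single 4 1), φ (Pi.single 3 1), p, φ (Pi.single 1 1),
    φ (Pi.single 0 1)] with hP
  have hPφ : φ P = 0 := by
    rw [linearForm_apply, h2]; simp [hP]; grind
  have hPQ : parabolicForm F P = 0 := by
    rw [parabolicForm_apply]; simp [hP]; grind
  by_cases hP0 : P = 0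
  · have hφ0 : φ = 0 := by
      refine LinearMap.ext fun v => ?_
      have e0 : φ (Pi.single 0 1) = 0 := congrFun hP0 4
      have e1 : φ (Pi.single 1 1) = 0 := congrFun hP0 3
      have e3 : φ (Pi.single 3 1) = 0 := congrFun hP0 1
      have e4 : φ (Pi.single 4 1) = 0 := congrFun hP0 0
      rw [linearForm_apply, e0, e1, h2, e3, e4]; simp
    obtain ⟨c, hc⟩ := h (Pi.single 0 1) (Pi.single 1 1) (by simp [hφ0]) (by simp [hφ0])
      (by simp [parabolicForm_apply]) (by simp [parabolicForm_apply])
      (by simp [parabolicForm_apply]) (by simp)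
    simpa using congrFun hc 1
  · have hspan : LinearMap.ker φ ≤ Submodule.span F {P, Pi.single 2 1} := by
      intro v hv
      rw [LinearMap.mem_ker] at hv
      obtain ⟨c, hc⟩ : ∃ c, c ^ 2 = parabolicForm F v := ⟨_, ht _⟩
      obtain ⟨d, hd⟩ := h P (v + c • Pi.single 2 1) hPφ (by simp [hv, h2]) hPQ
        (by rw [parabolicForm_apply] at *; simp; grind)
        (by
          rw [linearForm_apply, h2] at hv
          rw [parabolicForm_apply] at *
          simp [hP] at *
          grind) hP0
      rw [Submodule.mem_span_pair]
      refine ⟨d, c, ?_⟩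
      rw [← hd, add_assoc, ← add_smul, CharTwo.add_self_eq_zero, zero_smul, add_zero]
    have h1 := Submodule.finrank_mono hspan
    have h3 : Module.finrank F (Submodule.span F {P, (Pi.single 2 1 : Fin 5 → F)}) ≤ 2 := by
      classical
      have := finrank_span_finset_le_card (R := F) {P, (Pi.single 2 1 : Fin 5 → F)}
      rw [Finset.coe_pair] at this
      exact this.trans Finset.card_le_two
    have h4 := LinearMap.finrank_range_add_finrank_ker φ
    have h5 : Module.finrank F (LinearMap.range φ) ≤ 1 := by
      simpa using Submodule.finrank_le (LinearMap.range φ)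
    simp at h4
    omega

/-- If the Arf invariant were trivial, the section would be hyperbolic: a nonzero root c of c² + c =
ae + bd yields an explicit line of the quadric in the hyperplane. -/
theorem NoSingularLine.asSign_eq {φ : (Fin 5 → F) →ₗ[F] F} (h : NoSingularLine φ) :
    asSign ((φ (Pi.single 0 1) * φ (Pi.single 4 1) + φ (Pi.single 1 1) * φ (Pi.single 3 1)) /
      φ (Pi.single 2 1) ^ 2) = -1 := by
  have h2 := h.apply_nucleus_ne_zero t ht
  have h' := h.smul (inv_ne_zero h2)
  have h2' : ((φ (Pi.single 2 1))⁻¹ • φ) (Pi.single 2 1) = 1 := by simp [h2]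
  have hs : (φ (Pi.single 0 1) * φ (Pi.single 4 1) + φ (Pi.single 1 1) * φ (Pi.single 3 1)) /
      φ (Pi.single 2 1) ^ 2 = ((φ (Pi.single 2 1))⁻¹ • φ) (Pi.single 0 1) *
        ((φ (Pi.single 2 1))⁻¹ • φ) (Pi.single 4 1) + ((φ (Pi.single 2 1))⁻¹ • φ) (Pi.single 1 1) *
        ((φ (Pi.single 2 1))⁻¹ • φ) (Pi.single 3 1) := by
    simp only [LinearMap.smul_apply, smul_eq_mul]
    field_simp
  rw [hs]
  clear hs h h2
  generalize (φ (Pi.single 2 1))⁻¹ • φ = ψ at *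
  rw [asSign_eq_neg_one_iff]
  rintro ⟨w, hw⟩
  obtain ⟨c, hc, hc0⟩ : ∃ c : F, c ^ 2 + c = w ^ 2 + w ∧ c ≠ 0 := by
    by_cases hw0 : w = 0
    · exact ⟨1, by rw [hw0]; grind, one_ne_zero⟩
    · exact ⟨w, rfl, hw0⟩
  rw [hw] at hc
  set a := ψ (Pi.single 0 1)
  set b := ψ (Pi.single 1 1)
  set d := ψ (Pi.single 3 1)
  set e := ψ (Pi.single 4 1)
  obtain ⟨k, hk⟩ : ∃ k, k * c = d := ⟨d / c, by field_simp⟩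
  obtain ⟨l, hl⟩ : ∃ l, l * c = e := ⟨e / c, by field_simp⟩
  have hψ : ∀ v, ψ v = a * v 0 + b * v 1 + v 2 + d * v 3 + e * v 4 := fun v => by
    rw [linearForm_apply, h2', one_mul]
  -- These are the images of U₄ and U₅ under the transvection with centre (e, d, c, b, a), on which
  -- the quadratic form takes the value c. Composition with it turns ψ into the coordinate X₃, which
  -- vanishes on the line U₄U₅.
  obtain ⟨z, hz⟩ := h' ![k * e, k * d, d, 1 + k * b, k * a] ![l * e, l * d, e, l * b, 1 + l * a]
    (by rw [hψ]; simp; grind) (by rw [hψ]; simp; grind)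
    (by rw [parabolicForm_apply]; simp; grind) (by rw [parabolicForm_apply]; simp; grind)
    (by rw [parabolicForm_apply]; simp; grind)
    (fun h => by
      have e2 := congrFun h 2
      have e3 := congrFun h 3
      simp at e2 e3
      rw [e2] at hk
      simp [(mul_eq_zero.1 hk).resolve_right hc0] at e3)
  have z2 := congrFun hz 2
  have z3 := congrFun hz 3
  have z4 := congrFun hz 4
  simp at z2 z3 z4
  have hlk : l = z * k := mul_right_cancel₀ hc0 (by grind)
  have hz0 : z = 0 := by grind
  rw [hlk, hz0] at z4
  simp at z4

end Quadric

/-! ### Elliptic sections: absence of lines and number of points. -/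

section Elliptic

variable {F : Type*} [Field F]

theorem exists_ker_eq_of_finrank_eq_four (H : Submodule F (Fin 5 → F))
    (hH : Module.finrank F H = 4) : ∃ φ : (Fin 5 → F) →ₗ[F] F, LinearMap.ker φ = H := by
  have hlt : H < ⊤ := by
    rw [lt_top_iff_ne_top]
    rintro rfl
    simp at hH
  obtain ⟨φ, hφ, hle⟩ := Submodule.exists_le_ker_of_lt_top H hlt
  refine ⟨φ, (Submodule.eq_of_le_of_finrank_le hle ?_).symm⟩
  have h1 : LinearMap.ker φ < ⊤ := by
    rw [lt_top_iff_ne_top, Ne, LinearMap.ker_eq_top]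
    exact hφ
  have h2 := Submodule.finrank_lt h1.ne
  simp at h2
  omega

theorem hyperbolicPlane_prod_apply (f : QuadraticForm F (Fin 2 → F))
    (x : (Fin 2 → F) × (Fin 2 → F)) :
    ((QuadraticMap.proj (0 : Fin 2) 1 : QuadraticForm F (Fin 2 → F)).prod f) x =
      x.1 0 * x.1 1 + f x.2 := by
  simp

theorem prod_eq_zero_of_apply_zero {f : QuadraticForm F (Fin 2 → F)} (hf : f.Anisotropic)
    {x : (Fin 2 → F) × (Fin 2 → F)} (hx : x.1 0 * x.1 1 + f x.2 = 0)
    (h : x.1 0 * x.1 1 = 0) : x.2 = 0 := by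
  rw [h, zero_add] at hx
  exact hf _ hx

/-- The combinations w and w' of u and v that kill the first and the second hyperbolic coordinate
are singular, so anisotropy of f kills their components in its plane. Singularity of w + w' kills
what remains. Since u ≠ 0 has a nonzero hyperbolic coordinate, w = 0 or w' = 0 is a dependence that
expresses v through u. -/
theorem noSingularLine_of_isEllipticForm [CharP F 2] {φ : (Fin 5 → F) →ₗ[F] F}
    (h : IsEllipticForm ((parabolicForm F).restrict (LinearMap.ker φ))) : NoSingularLine φ := by
  obtain ⟨f, hf, ⟨e⟩⟩ := h
  intro u v hu hv hQu hQv hQuv hu0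
  have hp : parabolicPolar u v = 0 := by
    rwa [parabolicForm_add, hQu, hQv, zero_add, zero_add] at hQuv
  have he : ∀ x : LinearMap.ker φ, (e x).1 0 * (e x).1 1 + f (e x).2 = parabolicForm F x.1 := by
    intro x
    rw [← hyperbolicPlane_prod_apply, e.map_app]
    rfl
  set U : LinearMap.ker φ := ⟨u, hu⟩
  set V : LinearMap.ker φ := ⟨v, hv⟩
  have hcomb : ∀ a b : F, (e (a • U + b • V)).1 0 * (e (a • U + b • V)).1 1 +
      f (e (a • U + b • V)).2 = 0 := fun a b => by
    rw [he]; exact parabolicForm_lincomb hQu hQv hp a b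
  have h1 : ∀ a b : F, ∀ i, (e (a • U + b • V)).1 i = a * (e U).1 i + b * (e V).1 i := by
    intro a b i
    have : e (a • U + b • V) = a • e U + b • e V := by
      simp only [← QuadraticMap.IsometryEquiv.coe_toLinearEquiv, map_add, map_smul]
    rw [this]; simp
  set w := (e V).1 0 • U + (e U).1 0 • V with hw
  set w' := (e V).1 1 • U + (e U).1 1 • V with hw'
  have hw0 : (e w).1 0 = 0 := by rw [hw, h1]; grind
  have hw1 : (e w').1 1 = 0 := by rw [hw', h1]; grind
  have hw2 : (e w).2 = 0 := prod_eq_zero_of_apply_zero hf (hcomb _ _) (by rw [hw0, zero_mul])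
  have hw2' : (e w').2 = 0 :=
    prod_eq_zero_of_apply_zero hf (hcomb _ _) (by rw [hw1, mul_zero])
  have hsym : (e w).1 1 = (e w').1 0 := by rw [hw, hw', h1, h1]; grind
  have hww : e (w + w') = e w + e w' := by
    simp only [← QuadraticMap.IsometryEquiv.coe_toLinearEquiv, map_add]
  have h3 : (e w).1 1 = 0 := by
    have h4 : w + w' = ((e V).1 0 + (e V).1 1) • U + ((e U).1 0 + (e U).1 1) • V := by
      rw [hw, hw']; module
    have h5 := hcomb ((e V).1 0 + (e V).1 1) ((e U).1 0 + (e U).1 1)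
    rw [← h4, hww] at h5
    simp [hw0, hw1, hw2, hw2', ← hsym] at h5
    exact h5
  have hzero : ∀ x : LinearMap.ker φ, (e x).1 0 = 0 → (e x).1 1 = 0 → (e x).2 = 0 → x = 0 := by
    intro x h0 h1 h2
    have : e x = 0 := by
      refine Prod.ext (funext fun i => ?_) h2
      fin_cases i
      · exact h0
      · exact h1
    rw [← QuadraticMap.IsometryEquiv.coe_toLinearEquiv] at this
    simpa using this
  have hwz : w = 0 := hzero w hw0 h3 hw2
  have hwz' : w' = 0 := hzero w' (hsym ▸ h3) hw1 hw2'
  have hdep : ∀ a b : F, a ≠ 0 → b • U + a • V = 0 → ∃ c : F, v = c • u := by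
    intro a b ha hab
    have h6 : b • u + a • v = 0 := congrArg Subtype.val hab
    refine ⟨-b / a, ?_⟩
    have h7 : a • v = -b • u := by rw [neg_smul]; exact eq_neg_of_add_eq_zero_right h6
    rw [div_eq_inv_mul, mul_smul, ← h7, smul_smul, inv_mul_cancel₀ ha, one_smul]
  by_cases hU0 : (e U).1 0 = 0
  · by_cases hU1 : (e U).1 1 = 0
    · exfalso
      have h8 : (e U).2 = 0 := by
        refine prod_eq_zero_of_apply_zero hf ?_ (by rw [hU0, zero_mul])
        rw [he]; exact hQu
      exact hu0 (congrArg Subtype.val (hzero U hU0 hU1 h8))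
    · exact hdep _ _ hU1 hwz'
  · exact hdep _ _ hU0 hwz

/-- The points of the quadric of a linear form. -/
def sectionPoints (φ : (Fin 5 → F) →ₗ[F] F) : Set (ℙ F (Fin 5 → F)) :=
  parabolicQuadric F ∩ {P | P ∈ (LinearMap.ker φ).projectivization}

theorem mk_mem_sectionPoints (φ : (Fin 5 → F) →ₗ[F] F) (v : Fin 5 → F) (hv : v ≠ 0) :
    Projectivization.mk F v hv ∈ sectionPoints φ ↔ parabolicForm F v = 0 ∧ φ v = 0 := by
  rw [← mk_mem_quadricPoints _ v hv]
  rfl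

/-- Anisotropy of f leaves one singular point with first coordinate 0. The others, scaled to first
coordinate 1, are parametrised by y in F². -/
theorem ncard_sectionPoints_of_isEllipticForm [Fintype F] {φ : (Fin 5 → F) →ₗ[F] F}
    (h : IsEllipticForm ((parabolicForm F).restrict (LinearMap.ker φ))) :
    (sectionPoints φ).ncard = Fintype.card F ^ 2 + 1 := by
  obtain ⟨f, hf, ⟨e⟩⟩ := h
  have he : ∀ x : LinearMap.ker φ, (e x).1 0 * (e x).1 1 + f (e x).2 = parabolicForm F x.1 := by
    intro x
    rw [← hyperbolicPlane_prod_apply, e.map_app]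
    rfl
  set p : Option (Fin 2 → F) → (Fin 2 → F) × (Fin 2 → F) := fun o => match o with
    | none => (![0, 1], 0)
    | some y => (![1, -f y], y) with hp
  have hp0 : ∀ o, p o ≠ 0 := by
    rintro (_ | y) h
    · simpa [hp] using congrFun (congrArg Prod.fst h) 1
    · simpa [hp] using congrFun (congrArg Prod.fst h) 0
  have hpQ : ∀ o, (p o).1 0 * (p o).1 1 + f (p o).2 = 0 := by
    rintro (_ | y) <;> simp [hp]
  have hpinj : ∀ o o', ∀ c : F, p o = c • p o' → o = o' := by
    rintro (_ | y) (_ | y') c h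
    · rfl
    · have h0 := congrFun (congrArg Prod.fst h) 0
      have h1 := congrFun (congrArg Prod.fst h) 1
      simp [hp] at h0 h1
      simp [← h0] at h1
    · simpa [hp] using congrFun (congrArg Prod.fst h) 0
    · have h0 := congrFun (congrArg Prod.fst h) 0
      have h1 := congrArg Prod.snd h
      simp [hp] at h0 h1
      simp [h1, ← h0]
  have hpsurj : ∀ x : (Fin 2 → F) × (Fin 2 → F), x.1 0 * x.1 1 + f x.2 = 0 →
      ∃ o, ∃ c : F, x = c • p o := by
    intro x hx
    by_cases h0 : x.1 0 = 0
    · refine ⟨none, x.1 1, ?_⟩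
      have h2 : x.2 = 0 := prod_eq_zero_of_apply_zero hf hx (by rw [h0, zero_mul])
      refine Prod.ext (funext fun i => ?_) (by simpa [hp] using h2)
      fin_cases i
      · simpa [hp] using h0
      · simp [hp]
    · refine ⟨some ((x.1 0)⁻¹ • x.2), x.1 0, ?_⟩
      refine Prod.ext (funext fun i => ?_) (by simp [hp, h0])
      fin_cases i
      · simp [hp]
      · simp [hp, QuadraticMap.map_smul]
        field_simp
        linear_combination hx
  set g : Option (Fin 2 → F) → LinearMap.ker φ := fun o => e.symm (p o) with hg
  have heg : ∀ o, e (g o) = p o := fun o => e.toLinearEquiv.apply_symm_apply (p o)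
  have hg0 : ∀ o, (g o : Fin 5 → F) ≠ 0 := by
    intro o h0
    have h1 : g o = 0 := Subtype.ext h0
    have h2 := heg o
    rw [h1] at h2
    exact hp0 o (h2.symm.trans (map_zero e.toLinearEquiv))
  have hrange : sectionPoints φ = (fun o => Projectivization.mk F (g o : Fin 5 → F) (hg0 o)) ''
      Set.univ := by
    ext P
    induction P using Projectivization.ind with
    | h v hv =>
      rw [mk_mem_sectionPoints]
      constructor
      · rintro ⟨h1, h2⟩
        obtain ⟨o, c, hc⟩ := hpsurj (e ⟨v, h2⟩) (by rw [he]; exact h1)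
        refine ⟨o, trivial, ?_⟩
        rw [eq_comm, Projectivization.mk_eq_mk_iff']
        refine ⟨c, ?_⟩
        rw [← heg] at hc
        have h3 : e.toLinearEquiv ⟨v, h2⟩ = e.toLinearEquiv (c • g o) := by
          rw [map_smul]; exact hc
        exact (congrArg Subtype.val (e.toLinearEquiv.injective h3)).symm
      · rintro ⟨o, -, ho⟩
        rw [← mk_mem_sectionPoints φ v hv, ← ho, mk_mem_sectionPoints]
        exact ⟨by rw [← he, heg, hpQ], (g o).2⟩
  rw [hrange, Set.ncard_image_of_injective]
  · rw [Set.ncard_univ, Nat.card_eq_fintype_card]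
    simp
  · intro o o' hoo
    rw [Projectivization.mk_eq_mk_iff'] at hoo
    obtain ⟨c, hc⟩ := hoo
    apply hpinj o o' c
    have h1 : g o = c • g o' := Subtype.ext hc.symm
    rw [← heg, h1, ← heg]
    exact map_smul e.toLinearEquiv c _

end Elliptic

/-! ### Collinearity and linear relations. -/

section Collinear

variable {F V : Type*} [Field F] [AddCommGroup V] [Module F V]

theorem isCollinear_of_eq_lincomb {u a b : V} (hu : u ≠ 0) (ha : a ≠ 0) (hb : b ≠ 0) (k l : F)
    (h : u = k • a + l • b) : Projectivization.IsCollinear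
      ({Projectivization.mk F u hu, Projectivization.mk F a ha, Projectivization.mk F b hb} :
        Set (ℙ F V)) := by
  classical
  have hfin : Module.Finite F (Submodule.span F ({a, b} : Set V)) :=
    Module.Finite.span_of_finite F (Set.toFinite _)
  refine ⟨(Submodule.span F {a, b}).projectivization, ?_, ?_, ?_⟩
  · rw [OrderIso.apply_symm_apply]
    exact hfin
  · rw [OrderIso.apply_symm_apply]
    have := finrank_span_finset_le_card (R := F) {a, b}
    rw [Finset.coe_pair] at this
    exact this.trans Finset.card_le_two
  · rintro P (rfl | rfl | rfl)
    · rw [SetLike.mem_coe, Submodule.mk_mem_projectivization_iff, h]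
      exact Submodule.mem_span_pair.2 ⟨k, l, rfl⟩
    · rw [SetLike.mem_coe, Submodule.mk_mem_projectivization_iff]
      exact Submodule.subset_span (by simp)
    · rw [SetLike.mem_coe, Submodule.mk_mem_projectivization_iff]
      exact Submodule.subset_span (by simp)

theorem eq_of_smul_rep_add_smul_rep_eq_zero {A B : ℙ F V} {k l : F} (hk : k ≠ 0)
    (h : k • A.rep + l • B.rep = 0) : A = B := by
  rw [← A.mk_rep, ← B.mk_rep, Projectivization.mk_eq_mk_iff']
  refine ⟨-(l / k), ?_⟩
  rw [neg_smul, div_eq_inv_mul, mul_smul, neg_eq_iff_eq_neg, eq_neg_iff_add_eq_zero,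
    ← inv_smul_smul₀ hk A.rep, ← smul_add, add_comm, h, smul_zero]

theorem exists_relation_of_isCollinear {A B C : ℙ F V} (hAB : A ≠ B) (hAC : A ≠ C) (hBC : B ≠ C)
    (h : Projectivization.IsCollinear ({A, B, C} : Set (ℙ F V))) :
    ∃ k l m : F, k ≠ 0 ∧ l ≠ 0 ∧ m ≠ 0 ∧ k • A.rep + l • B.rep + m • C.rep = 0 := by
  obtain ⟨M, hfin, hM, hsub⟩ := h
  have hmem : ∀ P ∈ ({A, B, C} : Set (ℙ F V)), P.rep ∈ M.submodule := by
    intro P hP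
    rw [Projectivization.Subspace.mem_submodule_iff _ P.rep_nonzero, P.mk_rep]
    exact hsub hP
  set a : M.submodule := ⟨A.rep, hmem A (by simp)⟩
  set b : M.submodule := ⟨B.rep, hmem B (by simp)⟩
  set c : M.submodule := ⟨C.rep, hmem C (by simp)⟩
  have hdep : ¬ LinearIndependent F ![a, b, c] := by
    intro hli
    have := hli.fintype_card_le_finrank
    simp at this
    omega
  rw [Fintype.not_linearIndependent_iff] at hdep
  obtain ⟨g, hg, i, hi⟩ := hdep
  have hrel : g 0 • A.rep + g 1 • B.rep + g 2 • C.rep = 0 := by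
    have := congrArg Subtype.val hg
    simpa [Fin.sum_univ_three] using this
  have h0 : g 0 ≠ 0 := by
    intro h0
    rw [h0, zero_smul, zero_add] at hrel
    by_cases h1 : g 1 = 0
    · have h2 : g 2 ≠ 0 := by
        intro h2
        fin_cases i
        · exact hi h0
        · exact hi h1
        · exact hi h2
      rw [add_comm] at hrel
      exact hBC (eq_of_smul_rep_add_smul_rep_eq_zero h2 hrel).symm
    · exact hBC (eq_of_smul_rep_add_smul_rep_eq_zero h1 hrel)
  refine ⟨g 0, g 1, g 2, h0, ?_, ?_, hrel⟩
  · intro h1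
    rw [h1, zero_smul, add_zero] at hrel
    exact hAC (eq_of_smul_rep_add_smul_rep_eq_zero h0 hrel)
  · intro h2
    rw [h2, zero_smul, add_zero] at hrel
    exact hAB (eq_of_smul_rep_add_smul_rep_eq_zero h0 hrel)

theorem isCompleteCap_of_forall_exists_isCollinear [Finite (ℙ F V)] {S : Set (ℙ F V)} (hS : IsCap S)
    (h : ∀ P ∉ S, ∃ A ∈ S, ∃ B ∈ S, A ≠ B ∧
      Projectivization.IsCollinear ({P, A, B} : Set (ℙ F V))) : IsCompleteCap S := by
  refine ⟨hS, ?_⟩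
  rintro ⟨S', hS', hsub, hcard⟩
  have hne : ¬ S' ⊆ S := fun h' => by
    have := Set.ncard_le_ncard h' (Set.toFinite _)
    omega
  obtain ⟨P, hP, hPS⟩ := Set.not_subset.1 hne
  obtain ⟨A, hA, B, hB, hAB, hcol⟩ := h P hPS
  exact hS' P hP A (hsub hA) B (hsub hB) (fun h => hPS (h ▸ hA)) (fun h => hPS (h ▸ hB)) hAB hcol

end Collinear

/-! ### Images of the canonical ovoid under projectivities. -/

section Ovoid

variable {F : Type*} [Field F] (t : F →+* F)

/-- The image of the canonical Suzuki–Tits ovoid under a projectivity. -/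
def ovoidPoint (g : (Fin 5 → F) ≃ₗ[F] (Fin 5 → F)) (o : Option (F × F)) : ℙ F (Fin 5 → F) :=
  Projectivization.mk F (g (titsVec t o)) (fun h => titsVec_ne_zero t o (by simpa using h))

theorem mk_eq_ovoidPoint_iff {g : (Fin 5 → F) ≃ₗ[F] (Fin 5 → F)} {o : Option (F × F)}
    {v : Fin 5 → F} (hv : v ≠ 0) :
    Projectivization.mk F v hv = ovoidPoint t g o ↔ ∃ c : F, c • g (titsVec t o) = v := by
  rw [ovoidPoint, Projectivization.mk_eq_mk_iff']

theorem ovoidPoint_injective (g : (Fin 5 → F) ≃ₗ[F] (Fin 5 → F)) :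
    Function.Injective (ovoidPoint t g) := by
  intro o o' h
  rw [ovoidPoint, mk_eq_ovoidPoint_iff] at h
  obtain ⟨c, hc⟩ := h
  apply titsVec_eq_of_smul t (c := c)
  apply g.injective
  rw [map_smul, hc]

theorem map_map_sq_of_pow [Fintype F] {r : ℕ} (hcard : Fintype.card F = 2 ^ (2 * r + 1))
    (hpow : ∀ x, t x = x ^ 2 ^ r) (x : F) : t (t x) ^ 2 = x := by
  have h : 2 ^ r * (2 ^ r * 2) = Fintype.card F := by rw [hcard]; ring
  rw [hpow, hpow, ← pow_mul, ← pow_mul, h, FiniteField.pow_card]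

variable [CharP F 2]

theorem suzukiTitsOvoid_eq_range {r : ℕ} (hpow : ∀ x, t x = x ^ 2 ^ r) :
    suzukiTitsOvoid F r = Set.range (ovoidPoint t (LinearEquiv.refl F (Fin 5 → F))) := by
  have hs : ∀ x, x ^ 2 ^ (r + 1) = t x ^ 2 := fun x => by rw [hpow, ← pow_mul, pow_succ]
  ext P
  constructor
  · rintro (⟨x, y, z, w, h, h1, h2, rfl⟩ | rfl)
    · refine ⟨some (x, y), ?_⟩
      rw [eq_comm, mk_eq_ovoidPoint_iff]
      refine ⟨1, ?_⟩
      simp only [pow_add x, hs] at h1 h2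
      have hz : z = x * t x ^ 2 + t y ^ 2 := by grind
      have hw : w = x * (x * t x ^ 2 + t y ^ 2) + y ^ 2 := by grind
      rw [hz, hw, one_smul]
      rfl
    · refine ⟨none, ?_⟩
      rw [eq_comm, coordPoint, mk_eq_ovoidPoint_iff]
      refine ⟨1, ?_⟩
      ext i; fin_cases i <;> simp [titsVec]
  · rintro ⟨_ | ⟨x, y⟩, rfl⟩
    · right
      rw [Set.mem_singleton_iff, eq_comm, coordPoint, mk_eq_ovoidPoint_iff]
      refine ⟨1, ?_⟩
      ext i; fin_cases i <;> simp [titsVec]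
    · left
      refine ⟨x, y, x * t x ^ 2 + t y ^ 2, x * (x * t x ^ 2 + t y ^ 2) + y ^ 2,
        titsVec_ne_zero t (some (x, y)), ?_, ?_, rfl⟩
      · simp only [pow_add x, hs]; grind
      · simp only [pow_add x, hs]; grind

theorem exists_of_isSuzukiTitsOvoid {r : ℕ} (hpow : ∀ x, t x = x ^ 2 ^ r)
    {T : Set (ℙ F (Fin 5 → F))} (hT : IsSuzukiTitsOvoid r T) :
    ∃ g : (Fin 5 → F) ≃ₗ[F] (Fin 5 → F),
      (∀ v, parabolicForm F (g v) = 0 ↔ parabolicForm F v = 0) ∧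
      T = Set.range (ovoidPoint t g) := by
  obtain ⟨g, hg, rfl⟩ := hT
  refine ⟨g, fun v => ?_, ?_⟩
  · by_cases hv : v = 0
    · simp [hv]
    · have hgv : g v ≠ 0 := by simpa using hv
      rw [← mk_mem_quadricPoints _ v hv, ← mk_mem_quadricPoints _ (g v) hgv]
      change _ ∈ parabolicQuadric F ↔ _ ∈ parabolicQuadric F
      conv_lhs => rw [← hg]
      have hmap : Projectivization.mk F (g v) hgv =
        Projectivization.map g.toLinearMap g.injective (Projectivization.mk F v hv) := rfl
      rw [hmap, Set.mem_image]
      constructor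
      · rintro ⟨P, hP, hPv⟩
        rwa [← Projectivization.map_injective g.toLinearMap g.injective hPv]
      · exact fun h => ⟨_, h, rfl⟩
  · rw [suzukiTitsOvoid_eq_range t hpow, ← Set.range_comp]
    rfl

variable (ht : ∀ x, t (t x) ^ 2 = x)

theorem parabolicForm_titsVec (o : Option (F × F)) : parabolicForm F (titsVec t o) = 0 := by
  rw [parabolicForm_apply]
  rcases o with _ | ⟨x, y⟩ <;> simp [titsVec]
  grind

-- For two affine points the polar form is the form of `tits_norm_eq_zero` at X = x + x', Y = y +
-- y'.
include ht in
theorem eq_of_parabolicPolar_titsVec_eq_zero [Fintype F] {o o' : Option (F × F)}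
    (h : parabolicPolar (titsVec t o) (titsVec t o') = 0) : o = o' := by
  rw [parabolicPolar_apply] at h
  rcases o with _ | ⟨x, y⟩ <;> rcases o' with _ | ⟨x', y'⟩
  · rfl
  · simp [titsVec] at h
  · simp [titsVec] at h
  · simp [titsVec] at h
    obtain ⟨h1, h2⟩ := tits_norm_eq_zero t ht (x := x) (X := x + x') (Y := y + y')
      (by simp only [map_add]; grind)
    have hx : x = x' := by grind
    have hy : y = y' := by grind
    rw [hx, hy]

end Ovoid

/-! ### Transvections, and the three counts for an arbitrary ovoid. -/

section Sizes

variable {F : Type*} [Field F] [Fintype F] [CharP F 2] (t : F →+* F)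
  (ht : ∀ x, t (t x) ^ 2 = x) (g : (Fin 5 → F) ≃ₗ[F] (Fin 5 → F))
  (hg : ∀ v, parabolicForm F (g v) = 0 ↔ parabolicForm F v = 0)

/-- The transvection of the quadric with the given nonsingular centre. -/
noncomputable def parabolicTransvection (v : Fin 5 → F) : (Fin 5 → F) →ₗ[F] (Fin 5 → F) :=
  LinearMap.id + (parabolicPolar v).smulRight ((parabolicForm F v)⁻¹ • v)

omit [Fintype F] [CharP F 2] in
theorem parabolicTransvection_apply (v x : Fin 5 → F) :
    parabolicTransvection v x = x + (parabolicPolar v x * (parabolicForm F v)⁻¹) • v := by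
  simp [parabolicTransvection, smul_smul]

omit [Fintype F] [CharP F 2] in
theorem parabolicPolar_comm (u v : Fin 5 → F) : parabolicPolar u v = parabolicPolar v u := by
  simp only [parabolicPolar_apply]; ring

omit [Fintype F] in
theorem parabolicForm_transvection {v : Fin 5 → F} (hv : parabolicForm F v ≠ 0) (x : Fin 5 → F) :
    parabolicForm F (parabolicTransvection v x) = parabolicForm F x := by
  rw [parabolicTransvection_apply, parabolicForm_add, parabolicForm_smul, map_smul, smul_eq_mul,
    parabolicPolar_comm x v]
  field_simp
  grind

omit [Fintype F] in
theorem parabolicTransvection_injective {v : Fin 5 → F} (hv : parabolicForm F v ≠ 0) :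
    Function.Injective (parabolicTransvection v) := by
  rw [← LinearMap.ker_eq_bot, LinearMap.ker_eq_bot']
  intro x hx
  have h1 := parabolicForm_transvection hv x
  rw [hx, map_zero] at h1
  rw [parabolicTransvection_apply] at hx
  have h2 : x = -(parabolicPolar v x * (parabolicForm F v)⁻¹) • v := by
    rw [neg_smul]; exact eq_neg_of_add_eq_zero_left hx
  rw [h2, parabolicForm_smul] at h1
  have h3 := pow_eq_zero_iff two_ne_zero |>.1 ((mul_eq_zero.1 h1.symm).resolve_right hv)
  rw [h2, h3, zero_smul]

omit [Fintype F] [CharP F 2] in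
theorem parabolicPolar_ne_zero {R : Fin 5 → F} (hR : R ≠ 0) (hQ : parabolicForm F R = 0) :
    parabolicPolar R ≠ 0 := by
  intro h
  have h0 : R 4 = 0 := by simpa [parabolicPolar_apply] using LinearMap.congr_fun h (Pi.single 0 1)
  have h1 : R 3 = 0 := by simpa [parabolicPolar_apply] using LinearMap.congr_fun h (Pi.single 1 1)
  have h3 : R 1 = 0 := by simpa [parabolicPolar_apply] using LinearMap.congr_fun h (Pi.single 3 1)
  have h4 : R 0 = 0 := by simpa [parabolicPolar_apply] using LinearMap.congr_fun h (Pi.single 4 1)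
  rw [parabolicForm_apply, h0, h1] at hQ
  simp at hQ
  apply hR
  ext i; fin_cases i <;> assumption

include hg

omit [Fintype F] in
theorem parabolicForm_map_titsVec (o : Option (F × F)) :
    parabolicForm F (g (titsVec t o)) = 0 :=
  (hg _).2 (parabolicForm_titsVec t o)

-- Singular vectors are orthogonal exactly when their sum is singular, so it is enough that g
-- preserves the zeros of the quadratic form.
omit [Fintype F] in
theorem parabolicPolar_map_eq_zero_iff {u v : Fin 5 → F} (hu : parabolicForm F u = 0)
    (hv : parabolicForm F v = 0) : parabolicPolar (g u) (g v) = 0 ↔ parabolicPolar u v = 0 := by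
  have h := hg (u + v)
  rwa [map_add, parabolicForm_add, parabolicForm_add, (hg u).2 hu, (hg v).2 hv, hu, hv, add_zero,
    zero_add, zero_add] at h

include ht

theorem ncard_ovoid_section_eq {r : ℕ} (hcard : Fintype.card F = 2 ^ (2 * r + 1))
    {φ : (Fin 5 → F) →ₗ[F] F} (hφ : NoSingularLine φ) :
    ({o | φ (g (titsVec t o)) = 0}.ncard : ℤ) = Fintype.card F + 1 + 2 ^ (r + 1) ∨
      ({o | φ (g (titsVec t o)) = 0}.ncard : ℤ) = Fintype.card F + 1 - 2 ^ (r + 1) := by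
  have hφ' : NoSingularLine (φ ∘ₗ g.toLinearMap) :=
    hφ.comp g.toLinearMap g.injective fun v hv => (hg v).2 hv
  obtain ⟨S, hS, h⟩ := exists_ncard_titsVec_eq t ht (φ ∘ₗ g.toLinearMap)
    (hφ'.apply_nucleus_ne_zero t ht) (hφ'.asSign_eq t ht)
  have h2 : S ^ 2 = (2 ^ (r + 1)) ^ 2 := by
    rw [hS, hcard]; push_cast; ring
  rcases sq_eq_sq_iff_eq_or_eq_neg.1 h2 with rfl | rfl
  · exact Or.inl h
  · exact Or.inr h

theorem ncard_ovoid_section_polar_le {r : ℕ} (hr : 1 ≤ r) (hpow : ∀ x, t x = x ^ 2 ^ r)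
    {φ : (Fin 5 → F) →ₗ[F] F} (hφ : NoSingularLine φ) {R : Fin 5 → F} (hR : R ≠ 0)
    (hQ : parabolicForm F R = 0) :
    {o | φ (g (titsVec t o)) = 0 ∧ parabolicPolar R (g (titsVec t o)) = 0}.ncard ≤
      2 ^ (r + 1) := by
  obtain ⟨R, rfl⟩ := g.surjective R
  rw [hg] at hQ
  have hφ' : NoSingularLine (φ ∘ₗ g.toLinearMap) :=
    hφ.comp g.toLinearMap g.injective fun v hv => (hg v).2 hv
  have hset : {o | φ (g (titsVec t o)) = 0 ∧ parabolicPolar (g R) (g (titsVec t o)) = 0} =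
      {o | (φ ∘ₗ g.toLinearMap) (titsVec t o) = 0 ∧ parabolicPolar R (titsVec t o) = 0} := by
    ext o
    simp only [Set.mem_ofPred_eq,
      parabolicPolar_map_eq_zero_iff g hg hQ (parabolicForm_titsVec t o)]
    rfl
  rw [hset]
  exact ncard_titsVec_section_le t ht r hr hpow _ _ (hφ'.apply_nucleus_ne_zero t ht)
    (by simp [parabolicPolar_apply]) (parabolicPolar_ne_zero (fun h => hR (by simp [h])) hQ)

theorem card_add_one_le_ncard_ovoid_polar {R : Fin 5 → F} (hR : R ≠ 0)
    (hQ : parabolicForm F R = 0) (hRT : ∀ o, ∀ c : F, R ≠ c • g (titsVec t o)) :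
    Fintype.card F + 1 ≤ {o | parabolicPolar R (g (titsVec t o)) = 0}.ncard := by
  obtain ⟨R, rfl⟩ := g.surjective R
  rw [hg] at hQ
  have hset : {o | parabolicPolar (g R) (g (titsVec t o)) = 0} =
      {o | parabolicPolar R (titsVec t o) = 0} := by
    ext o
    simp only [Set.mem_ofPred_eq,
      parabolicPolar_map_eq_zero_iff g hg hQ (parabolicForm_titsVec t o)]
  rw [hset]
  refine (card_add_one_le_ncard_titsVec t ht (parabolicPolar R)
    (by simp [parabolicPolar_apply])).resolve_right ?_
  rintro ⟨o, c, h0, h1, h3, h4⟩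
  apply hRT o c
  rw [← map_smul]
  congr 1
  simp [parabolicPolar_apply] at h0 h1 h3 h4
  have hT := parabolicForm_titsVec t o
  rw [parabolicForm_apply] at hQ hT
  -- The polar form does not see the middle coordinate; it is recovered from singularity of both
  -- vectors, square roots being unique.
  have h2 : R 2 = c * titsVec t o 2 := by
    have h5 : (R 2 + c * titsVec t o 2) ^ 2 = 0 := by
      rw [h0, h1, h3, h4] at hQ
      grind
    have := pow_eq_zero_iff two_ne_zero |>.1 h5
    grind
  ext i; fin_cases i <;> simp <;> assumption

end Sizes

/-! ### The cap property. -/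

section Cap

variable {F : Type*} [Field F] [CharP F 2]

omit [CharP F 2] in
theorem coordPoint_two_rep : ∃ c : F, c ≠ 0 ∧ (coordPoint F 2).rep = c • Pi.single 2 1 := by
  obtain ⟨c, hc⟩ := Projectivization.exists_smul_eq_mk_rep F (Pi.single 2 1 : Fin 5 → F) (by simp)
  exact ⟨c, c.ne_zero, hc.symm⟩

/-- With a in the radical, the relation makes b and c orthogonal, so their whole span, which
contains a, is singular. -/
theorem parabolicForm_eq_zero_of_relation {k l m : F} {a b c : Fin 5 → F} (hk : k ≠ 0)
    (hl : l ≠ 0) (h : k • a + l • b + m • c = 0) (hb : parabolicForm F b = 0)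
    (hc : parabolicForm F c = 0) (ha : ∀ x, parabolicPolar a x = 0) : parabolicForm F a = 0 := by
  have h1 : parabolicPolar b c = 0 := by
    have h2 : parabolicPolar c (k • a + l • b + m • c) = 0 := by rw [h, map_zero]
    have h3 : parabolicPolar c c = 0 := by rw [parabolicPolar_apply]; grind
    rw [map_add, map_add, map_smul, map_smul, map_smul, parabolicPolar_comm c a, ha, h3,
      parabolicPolar_comm c b] at h2
    simpa [hl] using h2
  have h4 := parabolicForm_lincomb hb hc h1 l m
  have h5 : l • b + m • c = -k • a := by
    rw [neg_smul, eq_neg_iff_add_eq_zero, ← h]; abel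
  rw [h5, parabolicForm_smul] at h4
  simpa [hk] using h4

theorem parabolicPolar_eq_zero_of_relation {k l m : F} {a b c : Fin 5 → F} (hk : k ≠ 0)
    (hl : l ≠ 0) (h : k • a + l • b + m • c = 0) (ha : parabolicForm F a = 0)
    (hb : parabolicForm F b = 0) (hc : parabolicForm F c = 0) : parabolicPolar a b = 0 := by
  have h5 : k • a + l • b = -m • c := by
    rw [neg_smul, eq_neg_iff_add_eq_zero, ← h]
  have h6 := parabolicForm_add (k • a) (l • b)
  rw [h5, parabolicForm_smul, parabolicForm_smul, parabolicForm_smul, ha, hb, hc] at h6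
  rw [parabolicPolar_apply] at *
  simp only [Pi.smul_apply, smul_eq_mul] at h6
  have h7 : k * l * parabolicPolar a b = 0 := by
    rw [parabolicPolar_apply]; linear_combination -h6
  rw [parabolicPolar_apply] at h7
  simpa [hk, hl] using h7

/-- The union of two partial ovoids of the parabolic quadric and its nucleus is a cap. -/
theorem isCap_union_nucleus {E T : Set (ℙ F (Fin 5 → F))} (hE : E ⊆ parabolicQuadric F)
    (hT : T ⊆ parabolicQuadric F)
    (hEo : ∀ A ∈ E, ∀ B ∈ E, parabolicPolar A.rep B.rep = 0 → A = B)
    (hTo : ∀ A ∈ T, ∀ B ∈ T, parabolicPolar A.rep B.rep = 0 → A = B) :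
    IsCap (E ∪ T ∪ {coordPoint F 2}) := by
  intro A hA B hB C hC hAB hAC hBC hcol
  obtain ⟨k, l, m, hk, hl, hm, hrel⟩ := exists_relation_of_isCollinear hAB hAC hBC hcol
  have hrel1 : l • B.rep + k • A.rep + m • C.rep = 0 := by rw [← hrel]; abel
  have hrel2 : m • C.rep + k • A.rep + l • B.rep = 0 := by rw [← hrel]; abel
  have hrel3 : l • B.rep + m • C.rep + k • A.rep = 0 := by rw [← hrel]; abel
  have hNpol : ∀ x, parabolicPolar (coordPoint F 2).rep x = 0 := by
    intro x
    obtain ⟨c, hc, h⟩ := coordPoint_two_rep (F := F)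
    rw [h, parabolicPolar_apply]; simp
  have hNQ : parabolicForm F (coordPoint F 2).rep ≠ 0 := by
    obtain ⟨c, hc, h⟩ := coordPoint_two_rep (F := F)
    rw [h, parabolicForm_apply]; simp [hc]
  have hQ : ∀ P ∈ E ∪ T, parabolicForm F P.rep = 0 := by
    rintro P (hP | hP)
    · exact hE hP
    · exact hT hP
  rcases hA with hA | rfl
  · rcases hB with hB | rfl
    · rcases hC with hC | rfl
      · have pAB := parabolicPolar_eq_zero_of_relation hk hl hrel (hQ A hA) (hQ B hB) (hQ C hC)
        have pAC := parabolicPolar_eq_zero_of_relation hm hk hrel2 (hQ C hC) (hQ A hA) (hQ B hB)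
        have pBC := parabolicPolar_eq_zero_of_relation hl hm hrel3 (hQ B hB) (hQ C hC) (hQ A hA)
        rcases hA with hA | hA <;> rcases hB with hB | hB <;> rcases hC with hC | hC
        · exact hAB (hEo A hA B hB pAB)
        · exact hAB (hEo A hA B hB pAB)
        · exact hAC (hEo C hC A hA pAC).symm
        · exact hBC (hTo B hB C hC pBC)
        · exact hBC (hEo B hB C hC pBC)
        · exact hAC (hTo C hC A hA pAC).symm
        · exact hAB (hTo A hA B hB pAB)
        · exact hAB (hTo A hA B hB pAB)
      · exact hNQ (parabolicForm_eq_zero_of_relation hm hk hrel2 (hQ A hA) (hQ B hB) hNpol)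
    · have hC' := hC.resolve_right (fun h => hBC h.symm)
      exact hNQ (parabolicForm_eq_zero_of_relation hl hk hrel1 (hQ A hA) (hQ C hC') hNpol)
  · have hB' := hB.resolve_right (fun h => hAB h.symm)
    have hC' := hC.resolve_right (fun h => hAC h.symm)
    exact hNQ (parabolicForm_eq_zero_of_relation hk hl hrel (hQ B hB') (hQ C hC') hNpol)

end Cap

/-! ### Completeness and the size of the union. -/

/-- This is 2√(2q) < q + 1, which fails for r = 0. -/
theorem two_mul_two_pow_lt {n r : ℕ} (hr : 1 ≤ r) (hn : n = 2 ^ (2 * r + 1)) :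
    2 * 2 ^ (r + 1) < n + 1 := by
  have h1 : n = 2 ^ r * 2 ^ (r + 1) := by rw [hn]; ring
  have h2 : 2 ≤ 2 ^ r := by
    calc 2 = 2 ^ 1 := rfl
      _ ≤ 2 ^ r := Nat.pow_le_pow_right (by norm_num) hr
  have := Nat.mul_le_mul_right (2 ^ (r + 1)) h2
  omega

section Complete

variable {F : Type*} [Field F] [Fintype F] [CharP F 2] (t : F →+* F)
  (ht : ∀ x, t (t x) ^ 2 = x) (g : (Fin 5 → F) ≃ₗ[F] (Fin 5 → F))
  (hg : ∀ v, parabolicForm F (g v) = 0 ↔ parabolicForm F v = 0)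
  {r : ℕ} (hr : 1 ≤ r) (hpow : ∀ x, t x = x ^ 2 ^ r) (hcard : Fintype.card F = 2 ^ (2 * r + 1))
  {φ : (Fin 5 → F) →ₗ[F] F} (hφ : NoSingularLine φ)

omit [Fintype F] in
include hg in
theorem range_ovoidPoint_subset : Set.range (ovoidPoint t g) ⊆ parabolicQuadric F := by
  rintro _ ⟨o, rfl⟩
  exact (mk_mem_quadricPoints _ _ _).2 (parabolicForm_map_titsVec t g hg o)

include ht hg hφ in
theorem isCap_section_union_ovoid :
    IsCap (sectionPoints φ ∪ Set.range (ovoidPoint t g) ∪ {coordPoint F 2}) := by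
  refine isCap_union_nucleus Set.inter_subset_left (range_ovoidPoint_subset t g hg) ?_ ?_
  · intro A hA B hB h
    rw [← A.mk_rep, mk_mem_sectionPoints] at hA
    rw [← B.mk_rep, mk_mem_sectionPoints] at hB
    obtain ⟨c, hc⟩ := hφ A.rep B.rep hA.2 hB.2 hA.1 hB.1
      (by rw [parabolicForm_add, hA.1, hB.1, h, add_zero, add_zero]) A.rep_nonzero
    rw [← A.mk_rep, ← B.mk_rep, eq_comm, Projectivization.mk_eq_mk_iff']
    exact ⟨c, hc.symm⟩
  · rintro _ ⟨o, rfl⟩ _ ⟨o', rfl⟩ h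
    congr 1
    obtain ⟨c, hc⟩ := Projectivization.exists_smul_eq_mk_rep F (g (titsVec t o))
      (fun h => titsVec_ne_zero t o (by simpa using h))
    obtain ⟨c', hc'⟩ := Projectivization.exists_smul_eq_mk_rep F (g (titsVec t o'))
      (fun h => titsVec_ne_zero t o' (by simpa using h))
    rw [ovoidPoint, ovoidPoint, ← hc, ← hc', Units.smul_def, Units.smul_def, map_smul,
      parabolicPolar_comm, map_smul, smul_smul, smul_eq_mul] at h
    have h1 := (mul_eq_zero.1 h).resolve_left (by simp)
    rw [parabolicPolar_comm, parabolicPolar_map_eq_zero_iff g hg (parabolicForm_titsVec t o)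
      (parabolicForm_titsVec t o')] at h1
    exact eq_of_parabolicPolar_titsVec_eq_zero t ht h1

include ht hg hr hpow hcard hφ

/-- A point of the quadric outside a Suzuki–Tits ovoid and an elliptic section is collinear
with a point of each of them. -/
theorem exists_isCollinear_of_singular {v : Fin 5 → F} (hv : v ≠ 0) (hQ : parabolicForm F v = 0)
    (hT : Projectivization.mk F v hv ∉ Set.range (ovoidPoint t g)) :
    ∃ A ∈ sectionPoints φ, ∃ B ∈ Set.range (ovoidPoint t g), A ≠ B ∧
      Projectivization.IsCollinear ({Projectivization.mk F v hv, A, B} :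
        Set (ℙ F (Fin 5 → F))) := by
  have hRT : ∀ o, ∀ c : F, v ≠ c • g (titsVec t o) := fun o c h =>
    hT ⟨o, ((mk_eq_ovoidPoint_iff t hv).2 ⟨c, h.symm⟩).symm⟩
  have h1 := card_add_one_le_ncard_ovoid_polar t ht g hg hv hQ hRT
  have h2 := ncard_ovoid_section_polar_le t ht g hg hr hpow hφ hv hQ
  have h3 := two_mul_two_pow_lt hr hcard
  obtain ⟨o, ho, hoφ⟩ : ∃ o, parabolicPolar v (g (titsVec t o)) = 0 ∧
      φ (g (titsVec t o)) ≠ 0 := by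
    by_contra! hcon
    have h4 := Set.ncard_le_ncard (s := {o | parabolicPolar v (g (titsVec t o)) = 0})
      (t := {o | φ (g (titsVec t o)) = 0 ∧ parabolicPolar v (g (titsVec t o)) = 0})
      (fun o ho => ⟨hcon o ho, ho⟩) (Set.toFinite _)
    omega
  set b := g (titsVec t o)
  -- The vector v - k b is where the line through v and b meets the hyperplane; orthogonality of v
  -- and b makes it singular.
  set k := φ v / φ b
  have ha0 : v - k • b ≠ 0 := fun h => hRT o k (sub_eq_zero.1 h)
  have hb0 : b ≠ 0 := fun h => hoφ (by rw [h, map_zero])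
  have haφ : φ (v - k • b) = 0 := by
    rw [map_sub, map_smul, smul_eq_mul, div_mul_cancel₀ _ hoφ, sub_self]
  have haQ : parabolicForm F (v - k • b) = 0 := by
    have := parabolicForm_lincomb hQ (parabolicForm_map_titsVec t g hg o) ho 1 (-k)
    rwa [one_smul, neg_smul, ← sub_eq_add_neg] at this
  have haE := (mk_mem_sectionPoints φ _ ha0).2 ⟨haQ, haφ⟩
  refine ⟨_, haE, ovoidPoint t g o, ⟨o, rfl⟩, ?_,
    isCollinear_of_eq_lincomb hv ha0 hb0 1 k (by rw [one_smul, sub_add_cancel])⟩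
  intro hAB
  rw [hAB] at haE
  exact hoφ ((mk_mem_sectionPoints φ b hb0).1 haE).2

/-- A point other than the nucleus that is not on the quadric is collinear with a point of a
Suzuki–Tits ovoid and a point of an elliptic section. -/
theorem exists_isCollinear_of_nonsingular {v : Fin 5 → F} (hv : v ≠ 0)
    (hQ : parabolicForm F v ≠ 0) (hN : Projectivization.mk F v hv ≠ coordPoint F 2) :
    ∃ A ∈ sectionPoints φ, ∃ B ∈ Set.range (ovoidPoint t g), A ≠ B ∧
      Projectivization.IsCollinear ({Projectivization.mk F v hv, A, B} :
        Set (ℙ F (Fin 5 → F))) := by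
  have hφ' := hφ.comp (parabolicTransvection v) (parabolicTransvection_injective hQ)
    (fun x hx => by rw [parabolicForm_transvection hQ, hx])
  -- R is the singular vector with the same polar form as v: t ∘ t is the square root, and the
  -- nucleus lies in the radical.
  set R := v + t (t (parabolicForm F v)) • (Pi.single 2 1 : Fin 5 → F) with hRdef
  have hR : R ≠ 0 := by
    intro h
    apply hN
    rw [coordPoint, Projectivization.mk_eq_mk_iff']
    exact ⟨-t (t (parabolicForm F v)), by rw [neg_smul]; exact (eq_neg_of_add_eq_zero_left h).symm⟩
  have hRQ : parabolicForm F R = 0 := by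
    rw [hRdef, parabolicForm_add, parabolicForm_smul, ht, map_smul]
    simp [parabolicForm_apply, parabolicPolar_apply]
    grind
  have hRpol : ∀ x, parabolicPolar R x = parabolicPolar v x := by
    intro x; simp [hRdef, parabolicPolar_apply]
  have h1 := ncard_ovoid_section_eq t ht g hg hcard hφ'
  have h2 := ncard_ovoid_section_polar_le t ht g hg hr hpow hφ' hR hRQ
  have h3 := two_mul_two_pow_lt hr hcard
  obtain ⟨o, ho, hopol⟩ : ∃ o, φ (parabolicTransvection v (g (titsVec t o))) = 0 ∧
      parabolicPolar v (g (titsVec t o)) ≠ 0 := by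
    -- Otherwise all the points of T in the transformed hyperplane, at least q + 1 - 2^(r+1) of
    -- them, would be orthogonal to R, while at most 2^(r+1) can be.
    by_contra! hcon
    have h4 : {o | (φ ∘ₗ parabolicTransvection v) (g (titsVec t o)) = 0}.ncard ≤ 2 ^ (r + 1) :=
      (Set.ncard_le_ncard (t := {o | (φ ∘ₗ parabolicTransvection v) (g (titsVec t o)) = 0 ∧
        parabolicPolar R (g (titsVec t o)) = 0}) (fun o ho => ⟨ho, (hRpol _).trans (hcon o ho)⟩)
        (Set.toFinite _)).trans h2
    have h5 : (({o | (φ ∘ₗ parabolicTransvection v) (g (titsVec t o)) = 0}.ncard : ℕ) : ℤ) ≤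
      2 ^ (r + 1) := by exact_mod_cast h4
    have h6 : (2 : ℤ) * 2 ^ (r + 1) < Fintype.card F + 1 := by exact_mod_cast h3
    rcases h1 with h1 | h1 <;> rw [h1] at h5 <;> linarith [pow_pos (two_pos (α := ℤ)) (r + 1)]
  have hbQ := parabolicForm_map_titsVec t g hg o
  set b := g (titsVec t o) with hb
  have hb0 : b ≠ 0 := fun h => hopol (by rw [h, map_zero])
  have ha0 : parabolicTransvection v b ≠ 0 := fun h =>
    hb0 (parabolicTransvection_injective hQ (by rw [h, map_zero]))
  have haE := (mk_mem_sectionPoints φ _ ha0).2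
    ⟨(parabolicForm_transvection hQ b).trans hbQ, ho⟩
  set k := parabolicPolar v b * (parabolicForm F v)⁻¹ with hk
  have hk0 : k ≠ 0 := mul_ne_zero hopol (inv_ne_zero hQ)
  have hab : parabolicTransvection v b = b + k • v := parabolicTransvection_apply v b
  refine ⟨_, haE, ovoidPoint t g o, ⟨o, rfl⟩, ?_,
    isCollinear_of_eq_lincomb hv ha0 hb0 k⁻¹ (-k⁻¹) ?_⟩
  · intro hAB
    obtain ⟨c, hc⟩ := (mk_eq_ovoidPoint_iff t ha0).1 hAB
    rw [hab, ← hb] at hc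
    have h6 : k • v = (c - 1) • b := by rw [sub_smul, one_smul, hc, add_sub_cancel_left]
    have h7 := congrArg (parabolicForm F) h6
    rw [parabolicForm_smul, parabolicForm_smul, hbQ, mul_zero] at h7
    simp [hk0, hQ] at h7
  · rw [hab, smul_add, smul_smul, inv_mul_cancel₀ hk0, one_smul, neg_smul]
    abel

theorem isCompleteCap_section_union_ovoid :
    IsCompleteCap (sectionPoints φ ∪ Set.range (ovoidPoint t g) ∪ {coordPoint F 2}) := by
  refine isCompleteCap_of_forall_exists_isCollinear (isCap_section_union_ovoid t ht g hg hφ) ?_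
  intro P
  induction P using Projectivization.ind with
  | h v hv =>
    intro hP
    simp only [Set.mem_union, not_or, Set.mem_singleton_iff] at hP
    obtain ⟨A, hA, B, hB, h⟩ : ∃ A ∈ sectionPoints φ, ∃ B ∈ Set.range (ovoidPoint t g), A ≠ B ∧
        Projectivization.IsCollinear ({Projectivization.mk F v hv, A, B} :
          Set (ℙ F (Fin 5 → F))) := by
      by_cases hQ : parabolicForm F v = 0
      · exact exists_isCollinear_of_singular t ht g hg hr hpow hcard hφ hv hQ hP.1.2
      · exact exists_isCollinear_of_nonsingular t ht g hg hr hpow hcard hφ hv hQ hP.2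
    exact ⟨A, Or.inl (Or.inl hA), B, Or.inl (Or.inr hB), h⟩

omit ht hr hpow hcard hφ in
/-- The size of the union in terms of the size of the intersection. -/
theorem ncard_section_union_ovoid (hE : (sectionPoints φ).ncard = Fintype.card F ^ 2 + 1) :
    (sectionPoints φ ∪ Set.range (ovoidPoint t g) ∪ {coordPoint F 2}).ncard +
      {o | φ (g (titsVec t o)) = 0}.ncard = 2 * Fintype.card F ^ 2 + 3 := by
  have hT : (Set.range (ovoidPoint t g)).ncard = Fintype.card F ^ 2 + 1 := by
    rw [← Set.image_univ, Set.ncard_image_of_injective _ (ovoidPoint_injective t g),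
      Set.ncard_univ, Nat.card_eq_fintype_card]
    simp [sq]
  have hI : (sectionPoints φ ∩ Set.range (ovoidPoint t g)).ncard =
      {o | φ (g (titsVec t o)) = 0}.ncard := by
    rw [← Set.ncard_image_of_injective _ (ovoidPoint_injective t g)]
    congr 1
    have hmem : ∀ o, ovoidPoint t g o ∈ sectionPoints φ ↔ φ (g (titsVec t o)) = 0 := fun o =>
      (mk_mem_sectionPoints φ _ _).trans (and_iff_right (parabolicForm_map_titsVec t g hg o))
    ext P
    constructor
    · rintro ⟨hP, o, rfl⟩
      exact ⟨o, (hmem o).1 hP, rfl⟩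
    · rintro ⟨o, ho, rfl⟩
      exact ⟨(hmem o).2 ho, o, rfl⟩
  have hN : coordPoint F 2 ∉ sectionPoints φ ∪ Set.range (ovoidPoint t g) := by
    intro h
    have h1 : coordPoint F 2 ∈ parabolicQuadric F :=
      Set.union_subset Set.inter_subset_left (range_ovoidPoint_subset t g hg) h
    have h2 := (mk_mem_quadricPoints _ _ _).1 h1
    rw [parabolicForm_apply] at h2
    simp at h2
  have h1 := Set.ncard_union_add_ncard_inter (sectionPoints φ) (Set.range (ovoidPoint t g))
  rw [Set.union_singleton, Set.ncard_insert_of_notMem hN]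
  omega

end Complete

/-! ### Both sizes occur. -/

section Existence

variable {F : Type*} [Field F]

/-- The linear form `a X₁ + X₂ + X₃ + X₄`. -/
def ellipticLinearForm (a : F) : (Fin 5 → F) →ₗ[F] F where
  toFun v := a * v 0 + v 1 + v 2 + v 3
  map_add' u v := by simp; ring
  map_smul' c v := by simp; ring

theorem ellipticLinearForm_apply (a : F) (v : Fin 5 → F) :
    ellipticLinearForm a v = a * v 0 + v 1 + v 2 + v 3 := rfl

/-- Coordinates on the hyperplane `a X₁ + X₂ + X₃ + X₄ = 0` in which the parabolic form is the sum
of a hyperbolic plane and `x ^ 2 + x y + y ^ 2`. -/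
def ellipticCoordinates (a : F) :
    LinearMap.ker (ellipticLinearForm a) ≃ₗ[F] (Fin 2 → F) × (Fin 2 → F) where
  -- In characteristic two, X₃² = a²X₁² + X₂² + X₄² on the hyperplane; the term a²X₁² is absorbed
  -- into the hyperbolic partner of X₁.
  toFun v := (![v.1 0, v.1 4 + a ^ 2 * v.1 0], ![v.1 1, v.1 3])
  map_add' u v := by
    ext i <;> fin_cases i <;> simp; ring
  map_smul' c v := by
    ext i <;> fin_cases i <;> simp; ring
  invFun x := ⟨![x.1 0, x.2 0, -(a * x.1 0 + x.2 0 + x.2 1), x.2 1, x.1 1 - a ^ 2 * x.1 0], by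
    rw [LinearMap.mem_ker, ellipticLinearForm_apply]; simp; ring⟩
  left_inv v := by
    have hv := v.2
    rw [LinearMap.mem_ker, ellipticLinearForm_apply] at hv
    ext i
    fin_cases i <;> simp
    linear_combination -hv
  right_inv x := by
    ext i <;> fin_cases i <;> simp

theorem finrank_ker_ellipticLinearForm (a : F) :
    Module.finrank F (LinearMap.ker (ellipticLinearForm a)) = 4 := by
  rw [(ellipticCoordinates a).finrank_eq]
  simp

variable [CharP F 2] (t : F →+* F) (ht : ∀ x, t (t x) ^ 2 = x)
include ht

/-- A nontrivial zero of x² + xy + y² would give u² + u = 1, against `asSign_one`. -/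
theorem isEllipticForm_ellipticLinearForm (a : F) :
    IsEllipticForm ((parabolicForm F).restrict (LinearMap.ker (ellipticLinearForm a))) := by
  refine ⟨QuadraticMap.proj 0 0 + QuadraticMap.proj 0 1 + QuadraticMap.proj 1 1, ?_,
    ⟨⟨ellipticCoordinates a, fun v => ?_⟩⟩⟩
  · intro x hx
    simp at hx
    by_cases h1 : x 1 = 0
    · have h0 : x 0 = 0 := by simpa [h1] using hx
      ext i; fin_cases i <;> assumption
    · exfalso
      have h2 := asSign_one t ht
      rw [asSign_eq_neg_one_iff] at h2
      apply h2
      refine ⟨x 0 / x 1, ?_⟩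
      field_simp
      grind
  · have hv := v.2
    rw [LinearMap.mem_ker, ellipticLinearForm_apply] at hv
    rw [hyperbolicPlane_prod_apply]
    change _ = parabolicForm F v.1
    rw [parabolicForm_apply]
    simp [ellipticCoordinates]
    grind

theorem isEllipticSection_ellipticLinearForm (a : F) :
    IsEllipticSection (sectionPoints (ellipticLinearForm a)) :=
  ⟨_, finrank_ker_ellipticLinearForm a, isEllipticForm_ellipticLinearForm t ht a, rfl⟩

omit [CharP F 2] ht in
theorem isSuzukiTitsOvoid_suzukiTitsOvoid (r : ℕ) :
    IsSuzukiTitsOvoid r (suzukiTitsOvoid F r) := by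
  have h : Projectivization.map (LinearEquiv.refl F (Fin 5 → F)).toLinearMap
      (LinearEquiv.refl F (Fin 5 → F)).injective = id := Projectivization.map_id
  exact ⟨LinearEquiv.refl F _, by rw [h, Set.image_id], by rw [h, Set.image_id]⟩

/-- The parameter a enters the count only through χ(a), so a = 0 and a = 1 give opposite signs to
the same Tits sum. -/
theorem exists_ncard_ellipticLinearForm [Fintype F] {r : ℕ}
    (hcard : Fintype.card F = 2 ^ (2 * r + 1)) (s : ℤ) (hs : s = 1 ∨ s = -1) :
    ∃ a : F, ({o | ellipticLinearForm a (titsVec t o) = 0}.ncard : ℤ) =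
      Fintype.card F + 1 + s * 2 ^ (r + 1) := by
  have h1 : titsSum t (1 : F) ^ 2 = (2 ^ (r + 1)) ^ 2 := by
    rw [titsSum_sq t ht 1 (asSign_one t ht), hcard]; push_cast; ring
  have h2 : ∀ a : F, ({o | ellipticLinearForm a (titsVec t o) = 0}.ncard : ℤ) =
      Fintype.card F + 1 + asSign a * titsSum t 1 := by
    intro a
    rw [ncard_titsVec_of_four_eq_zero t ht (ellipticLinearForm a)] <;>
      simp [ellipticLinearForm_apply]
  rcases sq_eq_sq_iff_eq_or_eq_neg.1 h1 with h | h <;> rcases hs with rfl | rfl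
  · exact ⟨0, by rw [h2, h]; simp⟩
  · exact ⟨1, by rw [h2, h, asSign_one t ht]⟩
  · exact ⟨1, by rw [h2, h, asSign_one t ht]; ring⟩
  · exact ⟨0, by rw [h2, h]; simp⟩

end Existence

theorem mainTheorem1 {F : Type*} [Field F] [Finite F] (q r : ℕ) (hr : 1 ≤ r)
    (hq : q = 2 ^ (2 * r + 1)) (hF : Nat.card F = q) :
    (∀ E T : Set (ℙ F (Fin 5 → F)), IsEllipticSection E → IsSuzukiTitsOvoid r T →
      IsCompleteCap (E ∪ T ∪ {coordPoint F 2}) ∧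
      (((E ∪ T ∪ {coordPoint F 2}).ncard : ℝ) = 2 * (q : ℝ) ^ 2 - q + √(2 * (q : ℝ)) + 2 ∨
        ((E ∪ T ∪ {coordPoint F 2}).ncard : ℝ) = 2 * (q : ℝ) ^ 2 - q - √(2 * (q : ℝ)) + 2)) ∧
    (∃ E T : Set (ℙ F (Fin 5 → F)), IsEllipticSection E ∧ IsSuzukiTitsOvoid r T ∧
      ((E ∪ T ∪ {coordPoint F 2}).ncard : ℝ) = 2 * (q : ℝ) ^ 2 - q + √(2 * (q : ℝ)) + 2) ∧
    (∃ E T : Set (ℙ F (Fin 5 → F)), IsEllipticSection E ∧ IsSuzukiTitsOvoid r T ∧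
      ((E ∪ T ∪ {coordPoint F 2}).ncard : ℝ) = 2 * (q : ℝ) ^ 2 - q - √(2 * (q : ℝ)) + 2) := by
  have := Fintype.ofFinite F
  rw [Nat.card_eq_fintype_card] at hF
  have hcard : Fintype.card F = 2 ^ (2 * r + 1) := hF.trans hq
  have : CharP F 2 := by
    have : Fact (Nat.Prime 2) := ⟨Nat.prime_two⟩
    exact charP_of_card_eq_prime_pow hcard
  obtain ⟨t, hpow⟩ : ∃ t : F →+* F, ∀ x, t x = x ^ 2 ^ r :=
    ⟨iterateFrobenius F 2 r, fun x => iterateFrobenius_def 2 r x⟩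
  have ht := map_map_sq_of_pow t hcard hpow
  have hsqrt : √(2 * (q : ℝ)) = 2 ^ (r + 1) := by
    rw [Real.sqrt_eq_iff_mul_self_eq (by positivity) (by positivity), hq]
    push_cast; ring
  have hsize : ∀ (U n : ℕ) (s : ℝ), U + n = 2 * Fintype.card F ^ 2 + 3 →
      (n : ℝ) = Fintype.card F + 1 + s → (U : ℝ) = 2 * (q : ℝ) ^ 2 - q - s + 2 := by
    intro U n s h1 h2
    have h3 : (U : ℝ) + n = 2 * (Fintype.card F : ℝ) ^ 2 + 3 := by exact_mod_cast h1
    rw [← hF]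
    linarith
  rw [hsqrt]
  have hex : ∀ s : ℤ, s = 1 ∨ s = -1 → ∃ E T : Set (ℙ F (Fin 5 → F)), IsEllipticSection E ∧
      IsSuzukiTitsOvoid r T ∧ ((E ∪ T ∪ {coordPoint F 2}).ncard : ℝ) =
        2 * (q : ℝ) ^ 2 - q - s * 2 ^ (r + 1) + 2 := by
    intro s hs
    obtain ⟨a, ha⟩ := exists_ncard_ellipticLinearForm t ht hcard s hs
    refine ⟨_, _, isEllipticSection_ellipticLinearForm t ht a,
      isSuzukiTitsOvoid_suzukiTitsOvoid r, ?_⟩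
    rw [suzukiTitsOvoid_eq_range t hpow]
    exact hsize _ _ _ (ncard_section_union_ovoid t (LinearEquiv.refl F _) (fun _ => Iff.rfl)
      (ncard_sectionPoints_of_isEllipticForm (isEllipticForm_ellipticLinearForm t ht a)))
      (by exact_mod_cast ha)
  refine ⟨?_, ?_, ?_⟩
  · rintro E T ⟨H, hH, hell, rfl⟩ hT
    obtain ⟨φ, rfl⟩ := exists_ker_eq_of_finrank_eq_four H hH
    obtain ⟨g, hg, rfl⟩ := exists_of_isSuzukiTitsOvoid t hpow hT
    have hφ := noSingularLine_of_isEllipticForm hell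
    change IsCompleteCap (sectionPoints φ ∪ _ ∪ _) ∧
      (((sectionPoints φ ∪ _ ∪ _).ncard : ℝ) = _ ∨ ((sectionPoints φ ∪ _ ∪ _).ncard : ℝ) = _)
    refine ⟨isCompleteCap_section_union_ovoid t ht g hg hr hpow hcard hφ, ?_⟩
    have h1 := ncard_section_union_ovoid t g hg (ncard_sectionPoints_of_isEllipticForm hell)
    rcases ncard_ovoid_section_eq t ht g hg hcard hφ with h2 | h2
    -- The larger intersection gives the smaller union.
    · right
      exact hsize _ _ _ h1 (by exact_mod_cast h2)
    · left
      have h3 := hsize _ _ (-2 ^ (r + 1)) h1 (by rw [← sub_eq_add_neg]; exact_mod_cast h2)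
      rw [h3]; ring
  · obtain ⟨E, T, hE, hT, h⟩ := hex (-1) (Or.inr rfl)
    exact ⟨E, T, hE, hT, by rw [h]; push_cast; ring⟩
  · obtain ⟨E, T, hE, hT, h⟩ := hex 1 (Or.inl rfl)
    exact ⟨E, T, hE, hT, by rw [h]; push_cast; ring⟩
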